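/- Let $K$ be a field of characteristic zero, $K^*$ its group of units, and $\mathbb N=\{0,1,2,\dots\}$. In $\mathrm{End}_K(K[x])$ let $x$ denote multiplication by $x$, $\partial=\frac{d}{dx}$, $H:=\partial x$ (an invertible operator, $H(x^k)=(k+1)x^k$), $y:=H^{-1}\partial$ (so $yx=1$), and $E_{ij}:=x^iy^j-x^{i+1}y^{j+1}$ for $i,j\in\mathbb N$ (so $E_{ij}(x^k)=\delta_{jk}x^i$). Let $\mathbb A_1:=K\langle x,\partial,H^{-1}\rangle$ be the Jacobian algebra, $\mathbb S_1:=K\langle x,y\rangle\subseteq\mathbb A_1$ the algebra of one-sided inverses, both regarded as subalgebras of $\mathrm{End}_K(K[x])$, and $\mathbb G_1:=\mathrm{Aut}_{K\text{-alg}}(\mathbb A_1)$. Let $F:=\bigoplus_{i,j\in\mathbb N}KE_{ij}=M_\infty(K)$, and let $\mathrm{GL}_\infty(K):=(1+F)^*$ be the group of units of the monoid $1+F$. Let $E_\infty(K)$ be the subgroup of $\mathrm{GL}_\infty(K)$ generated by all $1+\lambda E_{ij}$ with $\lambda\in K$, $i\neq j$, and $U(K):=\{\mu(\lambda):=\lambda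 E_{00}+1-E_{00}\mid\lambda\in K^*\}$. For a unit $u$ of an algebra let $\omega_u:a\mapsto uau^{-1}$. The group $\mathrm{Inn}(\mathbb S_1)$ of inner automorphisms of $\mathbb S_1$ is identified with the subgroup $\{\omega_u\mid u\in\mathbb S_1^*\}$ of $\mathbb G_1$ (each $\omega_u$, $u\in\mathbb S_1^*$, being extended to $\mathbb A_1$ by the same formula; this is a well-defined isomorphism of groups). For $j\ge1$ let $(H-j)_1:=H-j+E_{j-1,j-1}$. The elements $H+i$ $(i\ge0)$ and $(H-j)_1$ $(j\ge1)$ are commuting units of $\mathbb A_1$; let $\mathcal H$ be the group of all finite products $\prod_{i\ge0}(H+i)^{n_i}\prod_{j\ge1}(H-j)_1^{n_{-j}}$, $(n_i)\in\mathbb Z^{(\mathbb Z)}$. For $\lambda\in K^*$ and $u\in\mathcal H$ let $t_\lambda,\mu_u\in\mathbb G_1$ be the automorphisms $$t_\lambda: x\mapsto\lambda x,\ y\mapsto\lambda^{-1}y,\ H^{\pm1}\mapsto H^{\pm1};\qquad \mu_u: x\mapsto xu,\ y\mapsto u^{-1}y,\ H^{\pm1}\mapsto H^{\pm1},$$ and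 let $\mathbb T^1:=\{t_\lambda\mid\lambda\in K^*\}$ and $\mathbb U_1:=\{\mu_u\mid u\in\mathcal H\}$, which are subgroups of $\mathbb G_1$. A semidirect product $A\ltimes B$ has $B$ as its normal factor. Theorem. 1. $\mathbb G_1=(\mathbb T^1\times\mathbb U_1)\ltimes\mathrm{Inn}(\mathbb S_1)$. 2. $\mathbb G_1\simeq(K^*\times\mathbb Z^{(\mathbb Z)})\ltimes\mathrm{GL}_\infty(K)$, by an isomorphism under which $t_\lambda$, $\mu_{H+i}$ $(i\ge0)$, $\mu_{(H-j)_1}$ $(j\ge1)$ and $\omega_v$ $(v\in\mathrm{GL}_\infty(K))$ correspond to $\lambda\in K^*$, to the basis vectors $e_i$ and $e_{-j}$ of $\mathbb Z^{(\mathbb Z)}$, and to $v\in\mathrm{GL}_\infty(K)$, respectively. 3. $[\mathbb G_1,\mathbb G_1]=\{\omega_u\mid u\in E_\infty(K)\}$, and $\mathbb G_1/[\mathbb G_1,\mathbb G_1]\simeq\mathbb T^1\times\mathbb U_1\times U(K)\simeq K^*\times\mathbb Z^{(\mathbb Z)}\times K^*$, where the class of $t\mu\,\omega_v$ ($t\in\mathbb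 T^1$, $\mu\in\mathbb U_1$, $v\in U(K)$) corresponds to $(t,\mu,v)$, and the classes of $t_\lambda$, $\mu_{H+i}$, $\mu_{(H-j)_1}$, $\omega_{\mu(\lambda)}$ correspond to $(\lambda,0,1)$, $(1,e_i,1)$, $(1,e_{-j},1)$, $(1,0,\lambda)$, respectively. 4. The group $\mathbb G_1$ is generated by the elements $t_\lambda$ $(\lambda\in K^*)$, $\mu_{H+i}$ $(i\in\mathbb N)$, $\mu_{(H-j)_1}$ $(j\in\mathbb N\setminus\{0\})$, and $\omega_v$ $(v\in\mathrm{GL}_\infty(K))$. -/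

import Mathlib

open Polynomial

namespace JacobianAlgebra

noncomputable section

/-- The inner automorphism `ω_u : a ↦ u a u⁻¹` of a `K`-algebra `A`, as a group homomorphism
in the unit `u`. Its range is the group `Inn A` of inner automorphisms. -/
def innerAut (K A : Type*) [Field K] [Ring A] [Algebra K A] : Aˣ →* (A ≃ₐ[K] A) where
  toFun u :=
    { toFun := fun a => u * a * (u⁻¹ : Aˣ)
      invFun := fun a => (u⁻¹ : Aˣ) * a * u
      left_inv := fun a => by simp [mul_assoc]
      right_inv := fun a => by simp [mul_assoc]
      map_mul' := fun a b => by simp [mul_assoc]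
      map_add' := fun a b => by simp [mul_add, add_mul]
      commutes' := fun r => by
        rw [← Algebra.commutes r (u : A), mul_assoc]
        simp }
  map_one' := by ext a; simp
  map_mul' u v := by ext a; simp [mul_assoc]

section Operators

variable (K : Type*) [Field K]

/-- `End_K(P₁)`, where `P₁ = K[x]`. -/
abbrev EndP : Type _ := Module.End K K[X]

/-- Multiplication by `x`. -/
def opX : EndP K := LinearMap.mulLeft K (X : K[X])

/-- The derivative `∂ = d/dx`. -/
def opD : EndP K := Polynomial.derivative

/-- `H = ∂ x`. -/
def opH : EndP K := opD K * opX K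

variable {K}

theorem end_ext {f g : EndP K} (h : ∀ k : ℕ, f (X ^ k) = g (X ^ k)) : f = g := by
  refine (Polynomial.basisMonomials K).ext fun k => ?_
  simpa [Polynomial.X_pow_eq_monomial] using h k

@[simp] theorem opX_pow (k : ℕ) : opX K (X ^ k) = X ^ (k + 1) := by
  simp [opX, pow_succ']

@[simp] theorem opH_pow (k : ℕ) : opH K (X ^ k) = ((k : K) + 1) • X ^ k := by
  simp [opH, opD, Polynomial.smul_eq_C_mul]

/-- The diagonal operators `x^k ↦ a_k x^k`. -/
def diag : (ℕ → K) →* EndP K where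
  toFun a := (Polynomial.basisMonomials K).constr K fun k => a k • (X ^ k : K[X])
  map_one' := by
    refine (Polynomial.basisMonomials K).ext fun k => ?_
    rw [Module.Basis.constr_basis]
    simp [Polynomial.X_pow_eq_monomial]
  map_mul' a b := by
    refine (Polynomial.basisMonomials K).ext fun k => ?_
    rw [Module.Basis.constr_basis, Module.End.mul_apply, Module.Basis.constr_basis, map_smul]
    have : (X ^ k : K[X]) = Polynomial.basisMonomials K k := by
      simp [Polynomial.X_pow_eq_monomial]
    conv_rhs => rw [this]
    rw [Module.Basis.constr_basis, smul_smul, mul_comm]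
    rfl

@[simp] theorem diag_pow (a : ℕ → K) (k : ℕ) : diag a (X ^ k) = a k • (X ^ k : K[X]) := by
  have : (X ^ k : K[X]) = Polynomial.basisMonomials K k := by
    simp [Polynomial.X_pow_eq_monomial]
  conv_lhs => rw [this]
  exact Module.Basis.constr_basis _ _ _ _

/-- The invertible diagonal operators. -/
def diagUnit : (ℕ → Kˣ) →* (EndP K)ˣ :=
  (Units.map diag).comp (MulEquiv.piUnits (M := fun _ : ℕ => K)).symm.toMonoidHom

@[simp] theorem diagUnit_pow (a : ℕ → Kˣ) (k : ℕ) :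
    (diagUnit a : EndP K) (X ^ k) = (a k : K) • (X ^ k : K[X]) := by
  exact diag_pow _ k

theorem diagUnit_injective : Function.Injective (diagUnit (K := K)) := by
  intro a b h
  funext k
  have h1 : (diagUnit a : EndP K) (X ^ k) = (diagUnit b : EndP K) (X ^ k) := by rw [h]
  rw [diagUnit_pow, diagUnit_pow] at h1
  have h2 := congrArg (fun p => Polynomial.coeff p k) h1
  simpa [Units.ext_iff] using h2

theorem opX_pow_pow (i k : ℕ) : (opX K ^ i) (X ^ k) = X ^ (k + i) := by
  induction i with
  | zero => simp
  | succ i ih => rw [pow_succ', Module.End.mul_apply, ih, opX_pow, add_assoc]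

/-- `(a_k) ↦ (a_0 a_1 ⋯ a_{k-1})`. -/
def cumProd : (ℕ → Kˣ) →* (ℕ → Kˣ) where
  toFun a k := ∏ l ∈ Finset.range k, a l
  map_one' := by funext k; simp
  map_mul' a b := by funext k; simp [Finset.prod_mul_distrib]

@[simp] theorem cumProd_succ (a : ℕ → Kˣ) (k : ℕ) : cumProd a (k + 1) = cumProd a k * a k :=
  Finset.prod_range_succ _ _

theorem diagUnit_inv_pow (a : ℕ → Kˣ) (k : ℕ) :
    (((diagUnit a)⁻¹ : (EndP K)ˣ) : EndP K) (X ^ k) = ((a k : K))⁻¹ • (X ^ k : K[X]) := by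
  rw [← map_inv, diagUnit_pow, Pi.inv_apply, Units.val_inv_eq_inv_val]

end Operators

section Jacobian

variable (K : Type*) [Field K] [CharZero K]

/-- `H` as an invertible element of `End_K(P₁)`. -/
def unitH : (EndP K)ˣ where
  val := opH K
  inv := diag fun k => ((k : K) + 1)⁻¹
  val_inv := end_ext fun k => by
    simp [smul_smul, inv_mul_cancel₀ (Nat.cast_add_one_ne_zero (R := K) k)]
  inv_val := end_ext fun k => by
    simp [smul_smul, mul_inv_cancel₀ (Nat.cast_add_one_ne_zero (R := K) k)]

/-- `H⁻¹`. -/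
def opHinv : EndP K := ((unitH K)⁻¹ : (EndP K)ˣ)

/-- `y = H⁻¹ ∂`. -/
def opY : EndP K := opHinv K * opD K

/-- The Jacobian algebra `𝔸₁`, the subalgebra of `End_K(P₁)` generated by the Weyl algebra
`K⟨x, ∂⟩` and `H⁻¹`. -/
def A1 : Subalgebra K (EndP K) := Algebra.adjoin K {opX K, opD K, opHinv K}

/-- The algebra `𝕊₁ = K⟨x, y⟩` of one-sided inverses, inside `End_K(P₁)`. -/
def S1 : Subalgebra K (EndP K) := Algebra.adjoin K {opX K, opY K}

/-- The matrix units `E_{ij} = x^i y^j - x^{i+1} y^{j+1}`. -/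
def E (i j : ℕ) : EndP K := opX K ^ i * opY K ^ j - opX K ^ (i + 1) * opY K ^ (j + 1)

/-- `F = ⊕ K E_{ij}`, the algebra (without `1`) `M_∞(K)` of infinite matrices. -/
def F : Submodule K (EndP K) := Submodule.span K (Set.range fun p : ℕ × ℕ => E K p.1 p.2)

variable {K}

@[simp] theorem opHinv_pow (k : ℕ) :
    opHinv K (X ^ k) = ((k : K) + 1)⁻¹ • (X ^ k : K[X]) := diag_pow _ k

@[simp] theorem opY_zero : opY K 1 = 0 := by
  simp [opY, opD]

@[simp] theorem opY_pow_succ (k : ℕ) : opY K (X ^ (k + 1)) = X ^ k := by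
  have h : opD K (X ^ (k + 1)) = ((k : K) + 1) • (X ^ k : K[X]) := by
    simp [opD, Polynomial.smul_eq_C_mul]
  rw [opY, Module.End.mul_apply, h, map_smul, opHinv_pow, smul_smul,
    mul_inv_cancel₀ (Nat.cast_add_one_ne_zero (R := K) k), one_smul]

theorem opY_pow_pow (j k : ℕ) :
    (opY K ^ j) (X ^ k) = if j ≤ k then (X ^ (k - j) : K[X]) else 0 := by
  induction j with
  | zero => simp
  | succ j ih =>
    rw [pow_succ', Module.End.mul_apply, ih]
    by_cases h : j ≤ k
    · rw [if_pos h]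
      by_cases h' : j + 1 ≤ k
      · rw [if_pos h']
        obtain ⟨m, rfl⟩ := Nat.exists_eq_add_of_le h'
        rw [show j + 1 + m - j = m + 1 by omega, opY_pow_succ,
          show j + 1 + m - (j + 1) = m by omega]
      · rw [if_neg h', show k - j = 0 by omega, pow_zero, opY_zero]
    · rw [if_neg h, if_neg (by omega), map_zero]

/-- `E_{ij}` is the matrix unit `x^k ↦ δ_{jk} x^i`. -/
theorem E_pow (i j k : ℕ) : E K i j (X ^ k) = if j = k then (X ^ i : K[X]) else 0 := by
  rw [E, LinearMap.sub_apply, Module.End.mul_apply, Module.End.mul_apply, opY_pow_pow,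
    opY_pow_pow]
  by_cases h : j = k
  · subst h
    rw [if_pos le_rfl, if_neg (by omega), if_pos rfl, map_zero, sub_zero, opX_pow_pow, Nat.sub_self,
      zero_add]
  · rw [if_neg h]
    by_cases h' : j + 1 ≤ k
    · rw [if_pos h', if_pos (by omega), opX_pow_pow, opX_pow_pow,
        show k - j + i = k - (j + 1) + (i + 1) by omega, sub_self]
    · rw [if_neg h', if_neg (by omega), map_zero, map_zero, sub_self]

theorem E_mul_E (i j k l : ℕ) : E K i j * E K k l = if j = k then E K i l else 0 := by
  refine end_ext fun m => ?_
  rw [Module.End.mul_apply, E_pow]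
  by_cases h : l = m
  · subst h
    by_cases h' : j = k
    · simp [h', E_pow]
    · simp [h', E_pow]
  · by_cases h' : j = k <;> simp [h, h', E_pow]

theorem E_mem_F (i j : ℕ) : E K i j ∈ F K := Submodule.subset_span ⟨(i, j), rfl⟩

theorem F_mul {a b : EndP K} (ha : a ∈ F K) (hb : b ∈ F K) : a * b ∈ F K := by
  have h := Submodule.mul_mem_mul ha hb
  rw [F, Submodule.span_mul_span] at h
  refine Submodule.span_le.2 ?_ h
  rintro _ ⟨_, ⟨p, rfl⟩, _, ⟨q, rfl⟩, rfl⟩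
  change E K p.1 p.2 * E K q.1 q.2 ∈ F K
  rw [E_mul_E]
  split_ifs
  · exact E_mem_F _ _
  · exact zero_mem _

theorem opX_mem_A1 : opX K ∈ A1 K := Algebra.subset_adjoin (by simp)
theorem opD_mem_A1 : opD K ∈ A1 K := Algebra.subset_adjoin (by simp)
theorem opHinv_mem_A1 : opHinv K ∈ A1 K := Algebra.subset_adjoin (by simp)
theorem opH_mem_A1 : opH K ∈ A1 K := mul_mem opD_mem_A1 opX_mem_A1
theorem opY_mem_A1 : opY K ∈ A1 K := mul_mem opHinv_mem_A1 opD_mem_A1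

theorem S1_le_A1 : S1 K ≤ A1 K := by
  refine Algebra.adjoin_le ?_
  rintro a (rfl | rfl)
  · exact opX_mem_A1
  · exact opY_mem_A1

theorem E_mem_S1 (i j : ℕ) : E K i j ∈ S1 K := by
  have hx : opX K ∈ S1 K := Algebra.subset_adjoin (by simp)
  have hy : opY K ∈ S1 K := Algebra.subset_adjoin (by simp)
  exact sub_mem (mul_mem (pow_mem hx _) (pow_mem hy _)) (mul_mem (pow_mem hx _) (pow_mem hy _))

theorem F_le_S1 {a : EndP K} (ha : a ∈ F K) : a ∈ S1 K := by
  have h : F K ≤ Subalgebra.toSubmodule (S1 K) := by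
    refine Submodule.span_le.2 ?_
    rintro _ ⟨p, rfl⟩
    exact E_mem_S1 _ _
  exact h ha

variable (K)

/-- The multiplicative monoid `1 + F = 1 + M_∞(K)`. -/
def onePlusF : Submonoid (EndP K) where
  carrier := {u | u - 1 ∈ F K}
  one_mem' := by simp
  mul_mem' {a b} ha hb := by
    have h : a * b - 1 = (a - 1) * (b - 1) + (a - 1) + (b - 1) := by
      rw [mul_sub, sub_mul, mul_one, one_mul]; abel
    change a * b - 1 ∈ F K
    rw [h]
    exact add_mem (add_mem (F_mul ha hb) ha) hb

/-- `GL_∞(K) = (1 + M_∞(K))^*`, the group of units of the monoid `1 + M_∞(K)`. -/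
abbrev GLInf : Type _ := (onePlusF K)ˣ

/-- `E_∞(K)`, the subgroup of `GL_∞(K)` generated by the elementary matrices `1 + λ E_{ij}`
with `i ≠ j`. -/
def EInf : Subgroup (GLInf K) :=
  Subgroup.closure {u | ∃ (i j : ℕ) (c : K), i ≠ j ∧ ((u : onePlusF K) : EndP K) = 1 + c • E K i j}

/-- `μ(λ) = λ E₀₀ + 1 - E₀₀`, as an element of `1 + F`. -/
def diagZero : K →* onePlusF K where
  toFun c := ⟨c • E K 0 0 + 1 - E K 0 0, by
    change c • E K 0 0 + 1 - E K 0 0 - 1 ∈ F K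
    have h : c • E K 0 0 + 1 - E K 0 0 - 1 = (c - 1) • E K 0 0 := by
      rw [sub_smul c (1 : K) (E K 0 0), one_smul]; abel
    rw [h]
    exact Submodule.smul_mem _ _ (E_mem_F 0 0)⟩
  map_one' := by ext1; simp
  map_mul' a b := by
    ext1
    have h : E K 0 0 * E K 0 0 = E K 0 0 := by rw [E_mul_E, if_pos rfl]
    simp only [Submonoid.coe_mul, mul_add, add_mul, mul_sub, sub_mul, mul_one, one_mul,
      smul_mul_assoc, mul_smul_comm, h, add_sub_cancel_right]
    rw [mul_comm a b, mul_smul b a (E K 0 0)]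
    abel

/-- The homomorphism `λ ↦ μ(λ)` from `K^*` to `GL_∞(K)`. -/
def muScalar : Kˣ →* GLInf K := Units.map (diagZero K)

/-- `U(K) = {μ(λ) | λ ∈ K^*}`. -/
def UK : Subgroup (GLInf K) := (muScalar K).range

/-- The inclusion `GL_∞(K) = (1 + F)^* ⊆ 𝕊₁^*`. -/
def GLInf.toS1 : GLInf K →* (S1 K)ˣ :=
  Units.map
    { toFun := fun u => ⟨u, by
        have h : (u : EndP K) - 1 ∈ F K := u.2
        simpa using add_mem (F_le_S1 h) (one_mem (S1 K))⟩
      map_one' := rfl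
      map_mul' := fun _ _ => rfl }

/-- The group `𝔾₁` of `K`-algebra automorphisms of `𝔸₁`. -/
abbrev G1 : Type _ := A1 K ≃ₐ[K] A1 K

/-- `u ↦ ω_u` for `u ∈ 𝕊₁^* ⊆ 𝔸₁^*`, with values in `𝔾₁`. -/
def omegaS1 : (S1 K)ˣ →* G1 K :=
  (innerAut K (A1 K)).comp (Units.map (Subalgebra.inclusion (S1_le_A1 (K := K))).toMonoidHom)

/-- `Inn(𝕊₁)` as a subgroup of `𝔾₁`: the automorphisms `ω_u` of `𝔸₁` with `u ∈ 𝕊₁^*`. -/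
def innS1 : Subgroup (G1 K) := (omegaS1 K).range

/-- `v ↦ ω_v` for `v ∈ GL_∞(K) = (1 + F)^*`, with values in `𝔾₁`. -/
def omegaGL : GLInf K →* G1 K := (omegaS1 K).comp (GLInf.toS1 K)

/-- The invertible operators that normalize `𝔸₁`. -/
def normA1 : Subgroup (EndP K)ˣ where
  carrier := {c | ∀ a ∈ A1 K, (c : EndP K) * a * (c⁻¹ : (EndP K)ˣ) ∈ A1 K ∧
    ((c⁻¹ : (EndP K)ˣ) : EndP K) * a * c ∈ A1 K}
  one_mem' := by simp
  mul_mem' {c d} hc hd := fun a ha => by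
    constructor
    · have := (hc _ (hd a ha).1).1
      simpa [mul_assoc] using this
    · have := (hd _ (hc a ha).2).2
      simpa [mul_assoc] using this
  inv_mem' {c} hc := fun a ha => by simpa using (hc a ha).symm

/-- Conjugation by an invertible operator that normalizes `𝔸₁`. -/
def conjA1 : normA1 K →* G1 K where
  toFun c :=
    { toFun := fun a => ⟨((c : (EndP K)ˣ) : EndP K) * a * ((c : (EndP K)ˣ)⁻¹ : (EndP K)ˣ),
        (c.2 a a.2).1⟩
      invFun := fun a => ⟨(((c : (EndP K)ˣ)⁻¹ : (EndP K)ˣ) : EndP K) * a * (c : (EndP K)ˣ),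
        (c.2 a a.2).2⟩
      left_inv := fun a => by ext1; simp [mul_assoc]
      right_inv := fun a => by ext1; simp [mul_assoc]
      map_mul' := fun a b => by ext1; simp [mul_assoc]
      map_add' := fun a b => by ext1; simp [mul_add, add_mul]
      commutes' := fun r => by
        ext1
        simp only [Subalgebra.coe_algebraMap]
        rw [← Algebra.commutes r (((c : (EndP K)ˣ)) : EndP K), mul_assoc]
        simp }
  map_one' := by ext a : 2; simp
  map_mul' c d := by ext a : 2; simp [mul_assoc]

/-- The units of `𝔸₁` that act diagonally on the monomials `x^k`. -/
def diagUnits : Subgroup (A1 K)ˣ :=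
  (diagUnit (K := K)).range.comap (Units.map (A1 K).val.toMonoidHom)

/-- The sequence of eigenvalues `(a_k)`, `u * x^k = a_k x^k`, of a diagonal unit `u`. -/
def eigen : diagUnits K →* (ℕ → Kˣ) :=
  (MonoidHom.ofInjective (diagUnit_injective (K := K))).symm.toMonoidHom.comp
    ((Units.map (A1 K).val.toMonoidHom).subgroupComap (diagUnit (K := K)).range)

variable {K}

theorem diagUnit_eigen (u : diagUnits K) :
    (diagUnit (eigen K u) : EndP K) = (((u : (A1 K)ˣ) : A1 K) : EndP K) := by
  have h := MonoidHom.apply_ofInjective_symm (diagUnit_injective (K := K))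
    (((Units.map (A1 K).val.toMonoidHom).subgroupComap (diagUnit (K := K)).range) u)
  exact congrArg Units.val h

theorem opD_eq : opD K = opH K * opY K := by
  have h : opH K * opHinv K = 1 := (unitH K).mul_inv
  rw [opY, ← mul_assoc, h, one_mul]

theorem conj_opX (a : ℕ → Kˣ) :
    (diagUnit (cumProd a) : EndP K) * opX K * ((diagUnit (cumProd a))⁻¹ : (EndP K)ˣ) =
      opX K * diagUnit a := by
  refine end_ext fun k => ?_
  simp only [Module.End.mul_apply, diagUnit_inv_pow, map_smul, opX_pow, diagUnit_pow,
    cumProd_succ, smul_smul, Units.val_mul]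
  rw [inv_mul_cancel_left₀ (Units.ne_zero _)]

theorem conj_opY (a : ℕ → Kˣ) :
    (diagUnit (cumProd a) : EndP K) * opY K * ((diagUnit (cumProd a))⁻¹ : (EndP K)ˣ) =
      ((diagUnit a)⁻¹ : (EndP K)ˣ) * opY K := by
  refine end_ext fun k => ?_
  cases k with
  | zero =>
    simp only [Module.End.mul_apply, diagUnit_inv_pow, map_smul]
    simp
  | succ k =>
    simp only [Module.End.mul_apply, diagUnit_inv_pow, map_smul, opY_pow_succ, diagUnit_pow,
      cumProd_succ, smul_smul, Units.val_mul]
    congr 1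
    rw [mul_inv, mul_right_comm, inv_mul_cancel₀ (Units.ne_zero _), one_mul]

theorem conj_opH (a : ℕ → Kˣ) :
    (diagUnit a : EndP K) * opH K * ((diagUnit a)⁻¹ : (EndP K)ˣ) = opH K := by
  refine end_ext fun k => ?_
  simp only [Module.End.mul_apply, diagUnit_inv_pow, map_smul, opH_pow, diagUnit_pow, smul_smul]
  congr 1
  rw [mul_left_comm, inv_mul_cancel₀ (Units.ne_zero _), mul_one]

theorem conj_opHinv (a : ℕ → Kˣ) :
    (diagUnit a : EndP K) * opHinv K * ((diagUnit a)⁻¹ : (EndP K)ˣ) = opHinv K := by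
  refine end_ext fun k => ?_
  simp only [Module.End.mul_apply, diagUnit_inv_pow, map_smul, opHinv_pow, diagUnit_pow, smul_smul]
  congr 1
  rw [mul_left_comm, inv_mul_cancel₀ (Units.ne_zero _), mul_one]

theorem diagUnit_eigen_inv (u : diagUnits K) :
    (((diagUnit (eigen K u))⁻¹ : (EndP K)ˣ) : EndP K) =
      ((((u : (A1 K)ˣ)⁻¹ : (A1 K)ˣ) : A1 K) : EndP K) := by
  have h := diagUnit_eigen u⁻¹
  rw [map_inv, map_inv] at h
  exact h

theorem conj_mem_A1 (u : diagUnits K) {b : EndP K} (hb : b ∈ A1 K) :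
    (diagUnit (cumProd (eigen K u)) : EndP K) * b *
      ((diagUnit (cumProd (eigen K u)))⁻¹ : (EndP K)ˣ) ∈ A1 K := by
  set c := diagUnit (cumProd (eigen K u)) with hc
  have hY : (c : EndP K) * opY K * (c⁻¹ : (EndP K)ˣ) ∈ A1 K := by
    rw [hc, conj_opY, diagUnit_eigen_inv]
    exact mul_mem (SetLike.coe_mem _) opY_mem_A1
  induction hb using Algebra.adjoin_induction with
  | mem b hb =>
    rcases hb with rfl | rfl | rfl
    · rw [hc, conj_opX, diagUnit_eigen]
      exact mul_mem opX_mem_A1 (SetLike.coe_mem _)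
    · have h : (c : EndP K) * opD K * (c⁻¹ : (EndP K)ˣ) =
          ((c : EndP K) * opH K * (c⁻¹ : (EndP K)ˣ)) *
            ((c : EndP K) * opY K * (c⁻¹ : (EndP K)ˣ)) := by
        rw [opD_eq]
        simp [mul_assoc]
      rw [h]
      refine mul_mem ?_ hY
      rw [hc, conj_opH]
      exact opH_mem_A1
    · rw [hc, conj_opHinv]
      exact opHinv_mem_A1
  | algebraMap r =>
    rw [← Algebra.commutes r (c : EndP K), mul_assoc, Units.mul_inv, mul_one]
    exact algebraMap_mem _ r
  | add a b _ _ ha hb =>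
    rw [mul_add, add_mul]
    exact add_mem ha hb
  | mul a b _ _ ha hb =>
    have h := mul_mem ha hb
    simpa [mul_assoc] using h

variable (K)

/-- For a diagonal unit `u` of `𝔸₁`, the automorphism of `𝔸₁` with
`x ↦ x u`, `y ↦ u⁻¹ y`, `H^{±1} ↦ H^{±1}`. It is the conjugation by the operator
`x^k ↦ a_0 ⋯ a_{k-1} x^k`, where `(a_k)` are the eigenvalues of `u`. -/
def twist : diagUnits K →* G1 K :=
  (conjA1 K).comp ((((diagUnit (K := K)).comp cumProd).comp (eigen K)).codRestrict (normA1 K)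
    fun u a ha => ⟨conj_mem_A1 u ha, by
      have h := conj_mem_A1 u⁻¹ ha
      rw [map_inv, map_inv, map_inv, inv_inv] at h
      exact h⟩)

variable {K}

theorem twist_x (u : diagUnits K) :
    twist K u ⟨opX K, opX_mem_A1⟩ = ⟨opX K, opX_mem_A1⟩ * ((u : (A1 K)ˣ) : A1 K) := by
  ext1
  exact (conj_opX (eigen K u)).trans (by rw [diagUnit_eigen]; rfl)

theorem twist_y (u : diagUnits K) :
    twist K u ⟨opY K, opY_mem_A1⟩ =
      (((u : (A1 K)ˣ)⁻¹ : (A1 K)ˣ) : A1 K) * ⟨opY K, opY_mem_A1⟩ := by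
  ext1
  exact (conj_opY (eigen K u)).trans (by rw [diagUnit_eigen_inv]; rfl)

theorem twist_H (u : diagUnits K) :
    twist K u ⟨opH K, opH_mem_A1⟩ = ⟨opH K, opH_mem_A1⟩ := by
  ext1
  exact conj_opH (cumProd (eigen K u))

theorem twist_Hinv (u : diagUnits K) :
    twist K u ⟨opHinv K, opHinv_mem_A1⟩ = ⟨opHinv K, opHinv_mem_A1⟩ := by
  ext1
  exact conj_opHinv (cumProd (eigen K u))

variable (K)

/-- The nonzero scalars, as diagonal units of `𝔸₁`. -/
def scalarUnit : Kˣ →* diagUnits K :=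
  (Units.map (algebraMap K (A1 K)).toMonoidHom).codRestrict (diagUnits K) fun c =>
    ⟨fun _ => c, Units.ext (end_ext fun k => by
      rw [diagUnit_pow]
      rfl)⟩

/-- The automorphisms `t_λ : x ↦ λ x, y ↦ λ⁻¹ y, H^{±1} ↦ H^{±1}` of `𝔸₁`. -/
def torus : Kˣ →* G1 K := (twist K).comp (scalarUnit K)

/-- The torus `𝕋¹ = {t_λ | λ ∈ K^*}`. -/
def T1 : Subgroup (G1 K) := (torus K).range

variable {K} in
theorem torus_x (c : Kˣ) :
    torus K c ⟨opX K, opX_mem_A1⟩ = (c : K) • ⟨opX K, opX_mem_A1⟩ := by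
  rw [Algebra.smul_def, Algebra.commutes]
  exact twist_x _

variable {K} in
theorem torus_y (c : Kˣ) :
    torus K c ⟨opY K, opY_mem_A1⟩ = ((c⁻¹ : Kˣ) : K) • ⟨opY K, opY_mem_A1⟩ := by
  rw [Algebra.smul_def]
  exact twist_y _

/-- The operators `H + i` for an integer `i ≥ 0`, and `(H - j)_1 = H - j + E_{j-1,j-1}` for
`i = -j` with `j ≥ 1`. -/
def hOp : ℤ → EndP K
  | .ofNat i => opH K + algebraMap K (EndP K) i
  | .negSucc j => opH K - algebraMap K (EndP K) ((j : K) + 1) + E K j j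

/-- The eigenvalues of `hOp`. -/
def hSeq (i : ℤ) (k : ℕ) : Kˣ :=
  if h : (k : ℤ) + 1 + i = 0 then 1 else Units.mk0 ((((k : ℤ) + 1 + i : ℤ)) : K) (by exact_mod_cast h)

variable {K}

theorem hOp_eq (i : ℤ) : hOp K i = diagUnit (hSeq K i) := by
  refine end_ext fun k => ?_
  rw [diagUnit_pow]
  cases i with
  | ofNat i =>
    have h : ¬ ((k : ℤ) + 1 + Int.ofNat i = 0) := by simp only [Int.ofNat_eq_natCast]; omega
    rw [hSeq, dif_neg h, hOp, LinearMap.add_apply, opH_pow, Module.algebraMap_end_apply, ← add_smul]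
    simp
  | negSucc j =>
    rw [hOp, LinearMap.add_apply, LinearMap.sub_apply, opH_pow, Module.algebraMap_end_apply, E_pow,
      ← sub_smul]
    by_cases h : j = k
    · subst h
      rw [hSeq, dif_pos (by omega)]
      simp
    · rw [hSeq, dif_neg (by omega), if_neg h]
      simp [Int.negSucc_eq, sub_eq_add_neg]

theorem E_mem_A1 (i j : ℕ) : E K i j ∈ A1 K := S1_le_A1 (E_mem_S1 i j)

theorem hOp_mem (i : ℤ) : hOp K i ∈ A1 K := by
  cases i with
  | ofNat i => exact add_mem opH_mem_A1 (algebraMap_mem _ _)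
  | negSucc j => exact add_mem (sub_mem opH_mem_A1 (algebraMap_mem _ _)) (E_mem_A1 j j)

theorem hSeq_inv_mem (i : ℤ) : (((diagUnit (hSeq K i))⁻¹ : (EndP K)ˣ) : EndP K) ∈ A1 K := by
  cases i with
  | ofNat i =>
    have h : (((diagUnit (hSeq K (Int.ofNat i)))⁻¹ : (EndP K)ˣ) : EndP K) =
        opY K ^ i * opHinv K * opX K ^ i := by
      refine end_ext fun k => ?_
      rw [diagUnit_inv_pow, Module.End.mul_apply, Module.End.mul_apply, opX_pow_pow, opHinv_pow,
        map_smul, opY_pow_pow, if_pos (by omega), Nat.add_sub_cancel, hSeq,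
        dif_neg (by simp only [Int.ofNat_eq_natCast]; omega)]
      simp only [Units.val_mk0]
      congr 2
      push_cast
      simp only [Int.ofNat_eq_natCast, Int.cast_natCast]
      ring
    rw [h]
    exact mul_mem (mul_mem (pow_mem opY_mem_A1 _) opHinv_mem_A1) (pow_mem opX_mem_A1 _)
  | negSucc j =>
    have h : (((diagUnit (hSeq K (Int.negSucc j)))⁻¹ : (EndP K)ˣ) : EndP K) =
        opX K ^ (j + 1) * opHinv K * opY K ^ (j + 1) +
          ∑ l ∈ Finset.range (j + 1), ((hSeq K (Int.negSucc j) l : K))⁻¹ • E K l l := by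
      refine end_ext fun k => ?_
      rw [diagUnit_inv_pow, LinearMap.add_apply, Module.End.mul_apply, Module.End.mul_apply,
        opY_pow_pow, LinearMap.sum_apply]
      simp only [LinearMap.smul_apply, E_pow]
      by_cases hk : j + 1 ≤ k
      · rw [if_pos hk, opHinv_pow, map_smul, opX_pow_pow, Nat.sub_add_cancel hk,
          Finset.sum_eq_zero, add_zero, hSeq, dif_neg (by omega)]
        · simp only [Units.val_mk0]
          congr 2
          rw [Nat.cast_sub hk, Int.negSucc_eq]
          push_cast
          ring
        · intro l hl
          rw [if_neg (by have := Finset.mem_range.1 hl; omega), smul_zero]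
      · rw [if_neg hk, map_zero, map_zero, zero_add,
          Finset.sum_eq_single_of_mem k (Finset.mem_range.2 (by omega))]
        · rw [if_pos rfl]
        · intro l _ hl
          rw [if_neg hl, smul_zero]
    rw [h]
    refine add_mem (mul_mem (mul_mem (pow_mem opX_mem_A1 _) opHinv_mem_A1)
      (pow_mem opY_mem_A1 _)) (sum_mem fun l _ => ?_)
    exact Subalgebra.smul_mem _ (E_mem_A1 l l) _

variable (K)

/-- The units `H + i` (`i ≥ 0`) and `(H - j)_1` (`i = -j`, `j ≥ 1`) of `𝔸₁`. -/
def hUnit (i : ℤ) : diagUnits K :=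
  ⟨{ val := ⟨hOp K i, hOp_mem i⟩
     inv := ⟨((diagUnit (hSeq K i))⁻¹ : (EndP K)ˣ), hSeq_inv_mem i⟩
     val_inv := by ext1; simp [hOp_eq]
     inv_val := by ext1; simp [hOp_eq] }, ⟨hSeq K i, Units.ext (hOp_eq i).symm⟩⟩

/-- The group `𝓗` of all products `∏_{i ≥ 0} (H + i)^{n_i} ∏_{j ≥ 1} (H - j)_1^{n_{-j}}` with
`(n_i) ∈ ℤ^{(ℤ)}`, i.e. the (commutative) group generated by the `H + i` and `(H - j)_1`. -/
def calH : Subgroup (diagUnits K) := Subgroup.closure (Set.range (hUnit K))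

/-- `H + i` (`i ≥ 0`) and `(H - j)_1` (`i = -j`, `j ≥ 1`) as elements of `𝓗`. -/
def hGen (i : ℤ) : calH K := ⟨hUnit K i, Subgroup.subset_closure ⟨i, rfl⟩⟩

/-- The automorphisms `μ_u : x ↦ x u, y ↦ u⁻¹ y, H^{±1} ↦ H^{±1}` of `𝔸₁`, for `u ∈ 𝓗`. -/
def mu : calH K →* G1 K := (twist K).comp (calH K).subtype

/-- `𝕌₁ = {μ_u | u ∈ 𝓗}`. -/
def U1 : Subgroup (G1 K) := (mu K).range

end Jacobian

end

end JacobianAlgebra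

open JacobianAlgebra

namespace JacobianAlgebra

noncomputable section

set_option linter.unusedSectionVars false

variable {K : Type*} [Field K] [CharZero K]

/-! Modulo the ideal `F` of finite matrices, the algebra `𝔸₁` consists of operators which on `x^k`,
for large `k`, are finite sums of shifts `x^k ↦ r(k) x^(k+n)`, with `r` a rational function whose
poles are integers. The structure of `𝔾₁` comes from combining this asymptotic picture with the fact
that `K[x]` is a simple module already over `F`.

Simplicity makes every automorphism `σ` the conjugation by an invertible operator `φ` of `K[x]`
(`exists_conj`), and `σ` preserves `F` (`map_mem_F`). Since `yx = 1`, the image `σ(x)` has a left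
inverse, and comparing extreme shifts leaves it a single shift whose coefficient has only integer
zeros and poles: a scalar times an element of `𝓗` (`exists_shift_of_mul_sub_one_mem_F`).
Codimensions of subspaces show that the shift is by `1` (`exists_map_xA`). So some `t_λ μ_u` agrees
with `σ` on `x` modulo `F`. An automorphism fixing `x` modulo `F` is conjugation by a `φ` that is
scalar on all high monomials; rescaling gives an element of `GL_∞(K)` (`exists_eq_omegaGL`). Hence
`σ = t_λ μ_u ω_v`.

Uniqueness of this factorization is the multiplicative independence of the functions `k ↦ k + i`
modulo scalars (`eq_one_of_eventually_eq_one`), together with the injectivity of `v ↦ ω_v`. As `𝕊₁`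
is commutative modulo `F`, its inner automorphisms fix `x` modulo `F`, so they are exactly the
`ω_v`.

For the abelianization, the determinant on `GL_∞(K)` has kernel `E_∞(K)` (`ker_detGL`) and is
invariant under `𝔾₁` (`detGL_of_conj`). Therefore `t_λ μ_u ω_v ↦ (λ, u, det v)` is a homomorphism to
an abelian group with kernel `ω(E_∞(K))`, and elementary matrices are commutators. -/

/-! ### The ideal `F` of finite matrices -/

theorem E_apply (i j : ℕ) (p : K[X]) : E K i j p = p.coeff j • (X ^ i : K[X]) := by
  conv_lhs => rw [p.as_sum_support_C_mul_X_pow]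
  rw [map_sum]
  simp only [← smul_eq_C_mul, map_smul, E_pow]
  by_cases h : j ∈ p.support
  · rw [Finset.sum_eq_single_of_mem j h]
    · simp
    · intro b _ hb
      simp [hb.symm]
  · rw [notMem_support_iff.1 h, zero_smul]
    refine Finset.sum_eq_zero fun b hb => ?_
    have : j ≠ b := fun e => h (e ▸ hb)
    simp [this]

theorem mul_E_mem_F (a : EndP K) (i j : ℕ) : a * E K i j ∈ F K := by
  have h : a * E K i j = (a (X ^ i)).sum fun l c => c • E K l j := by
    refine end_ext fun k => ?_
    rw [Module.End.mul_apply, E_pow, Polynomial.sum, LinearMap.sum_apply]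
    simp only [LinearMap.smul_apply, E_pow]
    split_ifs with h
    · conv_lhs => rw [(a (X ^ i)).as_sum_support_C_mul_X_pow]
      simp only [smul_eq_C_mul]
    · simp
  rw [h]
  exact sum_mem fun l _ => Submodule.smul_mem _ _ (E_mem_F _ _)

/-- Each column of an operator is a polynomial, hence finite, so a finite matrix is one with
finitely many nonzero columns. This turns congruence modulo `F` into equality on monomials of large
degree. -/
theorem mem_F_iff {a : EndP K} : a ∈ F K ↔ ∃ N : ℕ, ∀ k ≥ N, a (X ^ k) = 0 := by
  constructor
  · intro h
    induction h using Submodule.span_induction with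
    | mem x hx =>
      obtain ⟨⟨i, j⟩, rfl⟩ := hx
      exact ⟨j + 1, fun k hk => by simp only [E_pow]; rw [if_neg (by omega)]⟩
    | zero => exact ⟨0, fun _ _ => rfl⟩
    | add x y _ _ hx hy =>
      obtain ⟨N, hN⟩ := hx
      obtain ⟨M, hM⟩ := hy
      exact ⟨max N M, fun k hk => by
        rw [LinearMap.add_apply, hN k (le_trans (le_max_left _ _) hk),
          hM k (le_trans (le_max_right _ _) hk), add_zero]⟩
    | smul c x _ hx =>
      obtain ⟨N, hN⟩ := hx
      exact ⟨N, fun k hk => by rw [LinearMap.smul_apply, hN k hk, smul_zero]⟩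
  · rintro ⟨N, hN⟩
    have h : a = ∑ k ∈ Finset.range N, a * E K k k := by
      refine end_ext fun k => ?_
      rw [LinearMap.sum_apply]
      simp only [Module.End.mul_apply, E_pow]
      by_cases hk : k < N
      · rw [Finset.sum_eq_single_of_mem k (Finset.mem_range.2 hk)]
        · simp
        · intro b _ hb
          simp [hb]
      · rw [hN k (not_lt.1 hk), Finset.sum_eq_zero]
        intro b hb
        have := Finset.mem_range.1 hb
        rw [if_neg (by omega), map_zero]
    rw [h]
    exact sum_mem fun k _ => mul_E_mem_F _ _ _

theorem mul_mem_F_left (a : EndP K) {f : EndP K} (hf : f ∈ F K) : a * f ∈ F K := by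
  obtain ⟨N, hN⟩ := mem_F_iff.1 hf
  exact mem_F_iff.2 ⟨N, fun k hk => by rw [Module.End.mul_apply, hN k hk, map_zero]⟩

/-- Unlike on the left, `a` cannot be an arbitrary operator: it might send infinitely many monomials
into low degrees. The generators of `𝔸₁` lower degrees by at most one. -/
theorem mul_mem_F_right {f a : EndP K} (hf : f ∈ F K) (ha : a ∈ A1 K) : f * a ∈ F K := by
  induction ha using Algebra.adjoin_induction generalizing f with
  | mem b hb =>
    obtain ⟨N, hN⟩ := mem_F_iff.1 hf
    rcases hb with rfl | rfl | rfl
    · exact mem_F_iff.2 ⟨N, fun k hk => by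
        rw [Module.End.mul_apply, opX_pow, hN _ (by omega)]⟩
    · refine mem_F_iff.2 ⟨N + 1, fun k hk => ?_⟩
      obtain ⟨m, rfl⟩ := Nat.exists_eq_add_of_le' (show 1 ≤ k by omega)
      have h : opD K (X ^ (m + 1)) = ((m : K) + 1) • (X ^ m : K[X]) := by
        simp [opD, Polynomial.smul_eq_C_mul]
      rw [Module.End.mul_apply, h, map_smul, hN _ (by omega), smul_zero]
    · exact mem_F_iff.2 ⟨N, fun k hk => by
        rw [Module.End.mul_apply, opHinv_pow, map_smul, hN _ hk, smul_zero]⟩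
  | algebraMap r =>
    rw [← Algebra.commutes, ← Algebra.smul_def]
    exact Submodule.smul_mem _ _ hf
  | add a b _ _ ha hb =>
    rw [mul_add]
    exact add_mem (ha hf) (hb hf)
  | mul a b _ _ ha hb =>
    rw [← mul_assoc]
    exact hb (ha hf)

theorem F_le_A1 {a : EndP K} (ha : a ∈ F K) : a ∈ A1 K := S1_le_A1 (F_le_S1 ha)

/-! ### Automorphisms as conjugations; invariance of `F` -/

/-- Multiplication by the polynomial `p`, as an element of `𝔸₁`. -/
def mulPoly : K[X] →ₐ[K] A1 K := Polynomial.aeval ⟨opX K, opX_mem_A1⟩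

theorem mulPoly_apply_one (p : K[X]) : (mulPoly p : EndP K) 1 = p := by
  have h : (A1 K).val.comp mulPoly = Algebra.lmul K K[X] := by
    refine Polynomial.algHom_ext ?_
    simp only [mulPoly, AlgHom.comp_apply, aeval_X]
    rfl
  have h2 := congrArg (fun f : K[X] →ₐ[K] EndP K => f p 1) h
  simpa using h2

/-- A nonzero vector is sent to any given vector by a finite matrix. -/
theorem exists_mem_F_apply_eq {w : K[X]} (hw : w ≠ 0) (q : K[X]) : ∃ f ∈ F K, f w = q := by
  refine ⟨((w.leadingCoeff)⁻¹ • (mulPoly q : EndP K)) * E K 0 w.natDegree, mul_E_mem_F _ _ _, ?_⟩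
  rw [Module.End.mul_apply, E_apply, LinearMap.smul_apply, map_smul, pow_zero, mulPoly_apply_one,
    smul_smul]
  change (w.leadingCoeff⁻¹ * w.leadingCoeff) • q = q
  rw [inv_mul_cancel₀ (leadingCoeff_ne_zero.2 hw), one_smul]

/-- The matrix units as elements of `𝔸₁`. -/
def matUnit (i j : ℕ) : A1 K := ⟨E K i j, E_mem_A1 i j⟩

/-- This identifies the left ideal `𝔸₁ E₀₀` with the module `K[x]` through `p ↦ p(x) E₀₀`, so that
`K[x]` can be transported along an automorphism. -/
theorem mul_mulPoly_mul_matUnit (a : A1 K) (p : K[X]) :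
    a * mulPoly p * matUnit 0 0 = mulPoly ((a : EndP K) p) * matUnit 0 0 := by
  ext1
  refine end_ext fun k => ?_
  simp only [MulMemClass.coe_mul, Module.End.mul_apply, matUnit, E_pow]
  split_ifs
  · rw [pow_zero, mulPoly_apply_one, mulPoly_apply_one]
  · simp

theorem matUnit_ne_zero (i j : ℕ) : (matUnit i j : A1 K) ≠ 0 := by
  intro h
  have h1 := congrArg (fun a : A1 K => (a : EndP K) (X ^ j)) h
  simp [matUnit, E_pow] at h1

/-- Every automorphism of `𝔸₁` is the conjugation by an invertible operator. -/
theorem exists_conj (σ : G1 K) :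
    ∃ φ : (EndP K)ˣ, ∀ a : A1 K, (σ a : EndP K) = φ * a * (φ⁻¹ : (EndP K)ˣ) := by
  set f : A1 K := σ (matUnit 0 0) with hf
  have hf2 : f * f = f := by
    rw [hf, ← map_mul]
    congr 1
    ext1
    exact (E_mul_E 0 0 0 0).trans (if_pos rfl)
  have hf0 : (f : EndP K) ≠ 0 := by
    intro h
    refine matUnit_ne_zero (K := K) 0 0 (σ.injective ?_)
    rw [map_zero]
    exact Subtype.ext h
  obtain ⟨p, hp⟩ : ∃ p, (f : EndP K) p ≠ 0 := by
    by_contra! h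
    exact hf0 (LinearMap.ext h)
  set w := (f : EndP K) p with hw
  have hfw : (f : EndP K) w = w := by
    rw [hw, ← Module.End.mul_apply, ← MulMemClass.coe_mul, hf2]
  -- The vector `w` is fixed by `f = σ(E₀₀)`, so `p(x) E₀₀ ↦ σ(p(x)) w` is the map `𝔸₁ E₀₀ → K[x]`
  -- intertwining the action of `a` with that of `σ(a)`.
  let φ : EndP K :=
    { toFun := fun p => (σ (mulPoly p) : EndP K) w
      map_add' := fun p q => by simp
      map_smul' := fun c p => by simp }
  have hφ (a : A1 K) (p : K[X]) : (σ a : EndP K) (φ p) = φ ((a : EndP K) p) := by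
    change (σ a : EndP K) ((σ (mulPoly p) : EndP K) w) = (σ (mulPoly _) : EndP K) w
    have h := congrArg (fun b : A1 K => (σ b : EndP K) w) (mul_mulPoly_mul_matUnit a p)
    simpa only [map_mul, MulMemClass.coe_mul, Module.End.mul_apply, ← hf, hfw] using h
  have hφ1 : φ 1 = w := by
    change (σ (mulPoly 1) : EndP K) w = w
    simp
  -- Both halves use that elements of `F` send a nonzero vector to any vector: a nonzero `q` in the
  -- kernel could be moved to `1`, giving `w = 0`, and every vector has the form `σ(b') w = φ(b'
  -- 1)`.
  have hbij : Function.Bijective φ := by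
    constructor
    · rw [injective_iff_map_eq_zero]
      intro q hq
      by_contra hq0
      obtain ⟨b, hb, hbq⟩ := exists_mem_F_apply_eq hq0 1
      have := hφ ⟨b, F_le_A1 hb⟩ q
      rw [hq, map_zero, hbq, hφ1] at this
      exact hp this.symm
    · intro q
      obtain ⟨b, hb, hbq⟩ := exists_mem_F_apply_eq hp q
      refine ⟨((σ.symm ⟨b, F_le_A1 hb⟩ : A1 K) : EndP K) 1, ?_⟩
      rw [← hφ, hφ1, σ.apply_symm_apply]
      exact hbq
  let e := LinearEquiv.ofBijective φ hbij
  refine ⟨LinearMap.GeneralLinearGroup.ofLinearEquiv e, fun a => LinearMap.ext fun q => ?_⟩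
  obtain ⟨p, rfl⟩ := hbij.2 q
  rw [hφ]
  change _ = φ ((a : EndP K) (e.symm (e p)))
  rw [e.symm_apply_apply]

/-- The corner `E₀₀ 𝔸₁ E₀₀` is `K E₀₀`, so with `f = σ(E₀₀)` the corner `f 𝔸₁ f` is `K f`. A matrix
unit `E` with `f E f ≠ 0` then writes `f` as a multiple of `f E f`, which lies in the ideal `F`. -/
theorem map_matUnit_zero_mem_F (σ : G1 K) : (σ (matUnit 0 0) : EndP K) ∈ F K := by
  set f : A1 K := σ (matUnit 0 0) with hf
  have hf0 : (f : EndP K) ≠ 0 := by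
    intro h
    refine matUnit_ne_zero (K := K) 0 0 (σ.injective ?_)
    rw [map_zero]
    exact Subtype.ext h
  obtain ⟨i, hi⟩ : ∃ i : ℕ, (f : EndP K) (X ^ i) ≠ 0 := by
    by_contra! h
    exact hf0 (end_ext fun k => by simp [h])
  set w := (f : EndP K) (X ^ i) with hw
  -- The column index `deg w` makes the matrix unit pick out the leading coefficient of `w`, and the
  -- row index `i` sends the result back to `w` under `f`; hence `f E f` does not vanish at `x^i`.
  set b := σ.symm (matUnit i w.natDegree) with hb
  set c := ((b : EndP K) 1).coeff 0 with hc
  have h1 : matUnit 0 0 * b * matUnit 0 0 = c • (matUnit 0 0 : A1 K) := by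
    ext1
    refine end_ext fun k => ?_
    simp only [MulMemClass.coe_mul, Module.End.mul_apply, matUnit, E_pow]
    change _ = (c • E K 0 0) (X ^ k)
    rw [LinearMap.smul_apply, E_pow]
    split_ifs
    · rw [pow_zero, E_apply, pow_zero]
    · simp
  have h2 := congrArg σ h1
  rw [map_mul, map_mul, map_smul, ← hf, hb, σ.apply_symm_apply] at h2
  have h3 : (f : EndP K) * E K i w.natDegree * f = c • (f : EndP K) := congrArg Subtype.val h2
  have h4 := congrArg (fun a : EndP K => a (X ^ i)) h3
  simp only [Module.End.mul_apply, LinearMap.smul_apply, ← hw, E_apply, map_smul] at h4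
  have hc0 : c ≠ 0 := by
    intro h
    rw [h, zero_smul] at h4
    rcases smul_eq_zero.1 h4 with h5 | h5
    · exact leadingCoeff_ne_zero.2 hi h5
    · exact hi h5
  have h5 : (f : EndP K) = c⁻¹ • ((f : EndP K) * E K i w.natDegree * f) := by
    rw [h3, smul_smul, inv_mul_cancel₀ hc0, one_smul]
  rw [h5]
  exact Submodule.smul_mem _ _ (mul_mem_F_right (mul_E_mem_F _ _ _) f.2)

/-- Automorphisms of `𝔸₁` preserve `F`. -/
theorem map_mem_F (σ : G1 K) {a : A1 K} (ha : (a : EndP K) ∈ F K) : (σ a : EndP K) ∈ F K := by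
  obtain ⟨a, ha'⟩ := a
  change a ∈ F K at ha
  induction ha using Submodule.span_induction with
  | mem x hx =>
    obtain ⟨⟨i, j⟩, rfl⟩ := hx
    have h : (⟨E K i j, ha'⟩ : A1 K) = matUnit i 0 * matUnit 0 0 * matUnit 0 j := by
      ext1
      simp [matUnit, E_mul_E]
    have h2 : (σ ⟨E K i j, ha'⟩ : EndP K) =
        (σ (matUnit i 0) : EndP K) * σ (matUnit 0 0) * σ (matUnit 0 j) := by
      rw [h, map_mul, map_mul]; rfl
    exact h2 ▸ mul_mem_F_right (mul_mem_F_left _ (map_matUnit_zero_mem_F σ)) (SetLike.coe_mem _)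
  | zero =>
    have h : (σ ⟨0, ha'⟩ : EndP K) = 0 := congrArg Subtype.val (map_zero σ)
    rw [h]
    exact zero_mem _
  | add x y hx hy hx' hy' =>
    have h : (⟨x + y, ha'⟩ : A1 K) = ⟨x, F_le_A1 hx⟩ + ⟨y, F_le_A1 hy⟩ := rfl
    rw [h, map_add]
    exact add_mem (hx' _) (hy' _)
  | smul c x hx hx' =>
    have h : (⟨c • x, ha'⟩ : A1 K) = c • ⟨x, F_le_A1 hx⟩ := rfl
    rw [h, map_smul]
    exact Submodule.smul_mem _ _ (hx' _)


/-! ### Asymptotics of `𝔸₁` on high monomials: shifts with rational coefficients -/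

theorem eventually_eval_ne_zero {p : K[X]} (hp : p ≠ 0) :
    ∀ᶠ k : ℕ in Filter.atTop, p.eval (k : K) ≠ 0 := by
  have h : Set.Finite {k : ℕ | p.eval (k : K) = 0} := by
    have := (p.rootSet_finite K).preimage (f := fun k : ℕ => (k : K)) Nat.cast_injective.injOn
    refine this.subset fun k hk => ?_
    simpa [mem_rootSet, hp] using hk
  have h2 := h.compl_mem_cofinite
  rw [Nat.cofinite_eq_atTop] at h2
  exact h2

theorem eq_of_eventually_eval_eq {p q : K[X]}
    (h : ∀ᶠ k : ℕ in Filter.atTop, p.eval (k : K) = q.eval (k : K)) : p = q := by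
  by_contra hne
  obtain ⟨k, h1, h2⟩ := (h.and (eventually_eval_ne_zero (sub_ne_zero.2 hne))).exists
  exact h2 (by simp [h1])

variable (K) in
/-- The monoid of products of linear polynomials `X + i` with `i` an integer. -/
def intSplit : Submonoid K[X] := Submonoid.closure (Set.range fun i : ℤ => X + C (i : K))

theorem X_add_C_mem_intSplit (i : ℤ) : X + C (i : K) ∈ intSplit K :=
  Submonoid.subset_closure ⟨i, rfl⟩

theorem ne_zero_of_mem_intSplit {p : K[X]} (hp : p ∈ intSplit K) : p ≠ 0 := by
  refine Monic.ne_zero ?_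
  induction hp using Submonoid.closure_induction with
  | mem x hx =>
    obtain ⟨i, rfl⟩ := hx
    exact monic_X_add_C _
  | one => exact monic_one
  | mul x y _ _ hx hy => exact hx.mul hy

/-- Composing with a shift operator translates the argument of a coefficient by an integer; the
admissible denominators have to be stable under this. -/
theorem comp_mem_intSplit {p : K[X]} (hp : p ∈ intSplit K) (n : ℤ) :
    p.comp (X + C (n : K)) ∈ intSplit K := by
  induction hp using Submonoid.closure_induction with
  | mem x hx =>
    obtain ⟨i, rfl⟩ := hx
    have h : (X + C (i : K)).comp (X + C (n : K)) = X + C ((n + i : ℤ) : K) := by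
      simp [add_assoc]
    rw [h]
    exact X_add_C_mem_intSplit _
  | one => simp [one_mem]
  | mul x y _ _ hx hy =>
    rw [mul_comp]
    exact mul_mem hx hy

theorem exists_eq_C_mul_of_dvd {g p : K[X]} (hp : p ∈ intSplit K) (hg : g ∣ p) :
    ∃ c : Kˣ, ∃ q ∈ intSplit K, g = C (c : K) * q := by
  induction hp using Submonoid.closure_induction_left generalizing g with
  | one =>
    obtain ⟨r, hr, rfl⟩ := Polynomial.isUnit_iff.1 (isUnit_of_dvd_one hg)
    exact ⟨hr.unit, 1, one_mem _, by simp⟩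
  | mul_left x hx y hy ih =>
    obtain ⟨i, rfl⟩ := hx
    have hprime : Prime (X + C (i : K)) := by
      have := prime_X_sub_C (-(i : K))
      rwa [C_neg, sub_neg_eq_add] at this
    by_cases hd : X + C (i : K) ∣ g
    · obtain ⟨g', rfl⟩ := hd
      obtain ⟨c, q, hq, rfl⟩ := ih ((mul_dvd_mul_iff_left hprime.ne_zero).1 hg)
      exact ⟨c, _, mul_mem (X_add_C_mem_intSplit i) hq, by ring⟩
    · exact ih ((((hprime.irreducible.coprime_iff_not_dvd).2 hd).symm).dvd_of_dvd_mul_left hg)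

theorem eigen_hUnit (i : ℤ) : eigen K (hUnit K i) = hSeq K i := by
  refine diagUnit_injective (Units.ext ?_)
  rw [diagUnit_eigen, ← hOp_eq]
  rfl

theorem eventually_hSeq (i : ℤ) :
    ∀ᶠ k : ℕ in Filter.atTop, (hSeq K i k : K) = (X + C ((i + 1 : ℤ) : K)).eval (k : K) := by
  filter_upwards [Filter.eventually_ge_atTop (i.natAbs)] with k hk
  rw [hSeq, dif_neg (by omega)]
  simp only [Units.val_mk0, eval_add, eval_X, eval_C]
  push_cast
  ring

/-- The factor `X + i` comes from the generator of index `i - 1`, because `H` itself has eigenvalue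
`k + 1` on `x^k`. -/
theorem exists_eigen_eq {p : K[X]} (hp : p ∈ intSplit K) :
    ∃ u ∈ calH K, ∀ᶠ k : ℕ in Filter.atTop, (eigen K u k : K) = p.eval (k : K) := by
  induction hp using Submonoid.closure_induction with
  | mem x hx =>
    obtain ⟨i, rfl⟩ := hx
    refine ⟨hUnit K (i - 1), Subgroup.subset_closure ⟨_, rfl⟩, ?_⟩
    rw [eigen_hUnit]
    simpa using eventually_hSeq (K := K) (i - 1)
  | one => exact ⟨1, one_mem _, by simp⟩
  | mul x y _ _ hx hy =>
    obtain ⟨u, hu, hux⟩ := hx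
    obtain ⟨v, hv, hvy⟩ := hy
    refine ⟨u * v, mul_mem hu hv, ?_⟩
    filter_upwards [hux, hvy] with k h1 h2
    rw [map_mul, Pi.mul_apply, Units.val_mul, h1, h2, eval_mul]

/-- Quantifying over the naturals `m` equal to `k + n` lets `n` be negative without truncated
subtraction. -/
theorem eventually_natCast_add (n : ℤ) {P : ℕ → Prop} (hP : ∀ᶠ k in Filter.atTop, P k) :
    ∀ᶠ k : ℕ in Filter.atTop, ∀ m : ℕ, (m : ℤ) = k + n → P m := by
  obtain ⟨N, hN⟩ := Filter.eventually_atTop.1 hP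
  filter_upwards [Filter.eventually_ge_atTop (N + n.natAbs)] with k hk m hm
  exact hN m (by omega)

variable (K) in
/-- The operators `a` with `a * x^k = r(k) x^{k+n}` for all large `k`, where `r` is a rational
function whose poles are integers. -/
def shiftOps (n : ℤ) : Submodule K (EndP K) where
  carrier := {a | ∃ g : K[X], ∃ h ∈ intSplit K, ∀ᶠ k : ℕ in Filter.atTop, ∀ m : ℕ,
    (m : ℤ) = k + n → h.eval (k : K) • a (X ^ k) = g.eval (k : K) • (X ^ m : K[X])}
  zero_mem' := ⟨0, 1, one_mem _, by simp⟩
  add_mem' := by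
    rintro a b ⟨g, h, hh, H⟩ ⟨g', h', hh', H'⟩
    refine ⟨g * h' + g' * h, h * h', mul_mem hh hh', ?_⟩
    filter_upwards [H, H'] with k h1 h2 m hm
    rw [LinearMap.add_apply, smul_add, eval_mul, mul_smul, smul_comm, h1 m hm, mul_smul, h2 m hm,
      eval_add, eval_mul, eval_mul, smul_smul, smul_smul, ← add_smul]
    congr 1
    ring
  smul_mem' := by
    rintro c a ⟨g, h, hh, H⟩
    refine ⟨C c * g, h, hh, ?_⟩
    filter_upwards [H] with k h1 m hm
    rw [LinearMap.smul_apply, smul_comm, h1 m hm, smul_smul, eval_mul, eval_C]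

theorem mul_mem_shiftOps {a b : EndP K} {n m : ℤ} (ha : a ∈ shiftOps K n)
    (hb : b ∈ shiftOps K m) : a * b ∈ shiftOps K (n + m) := by
  obtain ⟨g, h, hh, H⟩ := ha
  obtain ⟨g', h', hh', H'⟩ := hb
  -- The operator `b` acts first and moves `x^k` to degree `k + m`, so the rational function of `a`
  -- is evaluated at `k + m`.
  refine ⟨g' * g.comp (X + C (m : K)), h' * h.comp (X + C (m : K)),
    mul_mem hh' (comp_mem_intSplit hh m), ?_⟩
  filter_upwards [H', eventually_natCast_add m H, Filter.eventually_ge_atTop m.natAbs]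
    with k h1 h2 hk l hl
  obtain ⟨j, hj⟩ := Int.eq_ofNat_of_zero_le (show 0 ≤ (k : ℤ) + m by omega)
  have hj' : (k : K) + (m : K) = (j : K) := by exact_mod_cast congrArg (Int.cast (R := K)) hj
  have e1 := h1 j hj.symm
  have e2 := h2 j hj.symm l (by omega)
  simp only [eval_mul, eval_comp, eval_add, eval_X, eval_C, hj']
  rw [Module.End.mul_apply, mul_comm, mul_smul, ← map_smul, e1, map_smul, smul_comm, e2, smul_smul]

theorem one_mem_shiftOps : (1 : EndP K) ∈ shiftOps K 0 :=
  ⟨1, 1, one_mem _, Filter.Eventually.of_forall fun k m hm => by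
    obtain rfl : m = k := by omega
    simp⟩

theorem A1_le_iSup_shiftOps {a : EndP K} (ha : a ∈ A1 K) : a ∈ ⨆ n, shiftOps K n := by
  have hle (n : ℤ) : shiftOps K n ≤ ⨆ n, shiftOps K n := le_iSup _ n
  induction ha using Algebra.adjoin_induction with
  | mem x hx =>
    rcases hx with rfl | rfl | rfl
    · refine hle 1 ⟨1, 1, one_mem _, Filter.Eventually.of_forall fun k m hm => ?_⟩
      obtain rfl : m = k + 1 := by omega
      simp
    · refine hle (-1) ⟨X, 1, one_mem _, Filter.Eventually.of_forall fun k m hm => ?_⟩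
      obtain rfl : k = m + 1 := by omega
      simp [opD, Polynomial.smul_eq_C_mul]
    · refine hle 0 ⟨1, X + C ((1 : ℤ) : K), X_add_C_mem_intSplit 1,
        Filter.Eventually.of_forall fun k m hm => ?_⟩
      obtain rfl : m = k := by omega
      simp [smul_smul, mul_inv_cancel₀ (Nat.cast_add_one_ne_zero (R := K) m)]
  | algebraMap r =>
    rw [Algebra.algebraMap_eq_smul_one]
    exact Submodule.smul_mem _ _ (hle 0 one_mem_shiftOps)
  | add x y _ _ hx hy => exact add_mem hx hy
  | mul x y _ _ hx hy =>
    have h := Submodule.mul_mem_mul hx hy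
    rw [Submodule.iSup_mul] at h
    simp only [Submodule.mul_iSup] at h
    refine (iSup_le fun n => iSup_le fun m => ?_ : _ ≤ ⨆ n, shiftOps K n) h
    exact (Submodule.mul_le.2 fun a ha b hb => mul_mem_shiftOps ha hb).trans (hle (n + m))

/-- Normal form of the elements of `𝔸₁` on monomials of large degree. -/
theorem exists_normal_form {a : EndP K} (ha : a ∈ A1 K) :
    ∃ (s : Finset ℤ) (g h : ℤ → K[X]), (∀ n, h n ∈ intSplit K) ∧ (∀ n ∈ s, g n ≠ 0) ∧
      ∀ᶠ k : ℕ in Filter.atTop, ∀ m : ℕ, (a (X ^ k)).coeff m =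
        if (m : ℤ) - k ∈ s then (g (m - k)).eval (k : K) / (h (m - k)).eval (k : K) else 0 := by
  obtain ⟨f, hf, rfl⟩ := (Submodule.mem_iSup_iff_exists_finsupp _ _).1 (A1_le_iSup_shiftOps ha)
  classical
  choose g h hh H using hf
  -- Different shifts reach different degrees and cannot cancel. Dropping the zero numerators leaves
  -- exactly the shifts that occur for all large `k`.
  refine ⟨f.support.filter fun n => g n ≠ 0, g, h, hh, fun n hn => (Finset.mem_filter.1 hn).2, ?_⟩
  have H1 : ∀ᶠ k : ℕ in Filter.atTop, ∀ n ∈ f.support, (h n).eval (k : K) ≠ 0 ∧ 0 ≤ (k : ℤ) + n ∧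
      ∀ m : ℕ, (m : ℤ) = k + n →
        (h n).eval (k : K) • f n (X ^ k) = (g n).eval (k : K) • (X ^ m : K[X]) := by
    rw [Filter.eventually_all_finset]
    intro n _
    filter_upwards [H n, eventually_eval_ne_zero (ne_zero_of_mem_intSplit (hh n)),
      Filter.eventually_ge_atTop n.natAbs] with k h1 h2 h3
    exact ⟨h2, by omega, h1⟩
  filter_upwards [H1] with k hk m
  have hterm (n : ℤ) (hn : n ∈ f.support) : (f n (X ^ k)).coeff m =
      if (m : ℤ) - k = n then (g n).eval (k : K) / (h n).eval (k : K) else 0 := by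
    obtain ⟨h1, h2, h3⟩ := hk n hn
    obtain ⟨j, hj⟩ := Int.eq_ofNat_of_zero_le h2
    have h4 := congrArg (fun p => coeff p m) (h3 j hj.symm)
    simp only [coeff_smul, coeff_X_pow, smul_eq_mul] at h4
    rw [← mul_right_inj' h1, h4]
    by_cases hm : m = j
    · rw [if_pos hm, if_pos (by omega), mul_one, mul_div_cancel₀ _ h1]
    · rw [if_neg hm, if_neg (by omega), mul_zero, mul_zero]
  rw [Finsupp.sum, LinearMap.sum_apply, finsetSum_coeff, Finset.sum_congr rfl hterm,
    Finset.sum_ite_eq]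
  simp only [Finset.mem_filter]
  by_cases hs : (m : ℤ) - k ∈ f.support
  · by_cases hg : g ((m : ℤ) - k) = 0
    · rw [if_pos hs, if_neg (by tauto), hg, eval_zero, zero_div]
    · rw [if_pos hs, if_pos ⟨hs, hg⟩]
  · rw [if_neg hs, if_neg (by tauto)]

theorem coeff_apply (a : EndP K) (p : K[X]) (m : ℕ) :
    (a p).coeff m = ∑ j ∈ p.support, p.coeff j * (a (X ^ j)).coeff m := by
  conv_lhs => rw [p.as_sum_support_C_mul_X_pow]
  rw [map_sum, finsetSum_coeff]
  simp only [← smul_eq_C_mul, map_smul, coeff_smul, smul_eq_mul]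

/-- `s` is the set of shifts by which `a` acts on monomials of large degree. -/
def HasShifts (a : EndP K) (s : Finset ℤ) : Prop :=
  ∀ᶠ k : ℕ in Filter.atTop, ∀ m : ℕ, (a (X ^ k)).coeff m ≠ 0 ↔ (m : ℤ) - k ∈ s

/-- If `q + r` arises in only one way as a sum of shifts, nothing cancels the coefficient of
`x^(k+q+r)` in `a b x^k`. As `a b x^k = x^k` for large `k`, this degree is `k`. -/
theorem HasShifts.add_eq_zero {a b : EndP K} {s t : Finset ℤ} (ha : HasShifts a s)
    (hb : HasShifts b t) (hab : a * b - 1 ∈ F K) {q r : ℤ} (hq : q ∈ s) (hr : r ∈ t)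
    (huniq : ∀ n ∈ s, ∀ m ∈ t, n + m = q + r → m = r) : q + r = 0 := by
  obtain ⟨N, hN⟩ := mem_F_iff.1 hab
  have ha' : ∀ᶠ k : ℕ in Filter.atTop, ∀ m ∈ t, ∀ j : ℕ, (j : ℤ) = k + m →
      ∀ i : ℕ, (a (X ^ j)).coeff i ≠ 0 ↔ (i : ℤ) - j ∈ s :=
    (Filter.eventually_all_finset t).2 fun m _ => eventually_natCast_add m ha
  obtain ⟨k, h1, h2, h3⟩ := (ha'.and (hb.and
    (Filter.eventually_ge_atTop (N + q.natAbs + r.natAbs)))).exists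
  obtain ⟨i, hi⟩ := Int.eq_ofNat_of_zero_le (show 0 ≤ (k : ℤ) + q + r by omega)
  obtain ⟨j, hj⟩ := Int.eq_ofNat_of_zero_le (show 0 ≤ (k : ℤ) + r by omega)
  have hX : (a * b) (X ^ k) = X ^ k := by
    have := hN k (by omega)
    rwa [LinearMap.sub_apply, Module.End.one_apply, sub_eq_zero] at this
  have hne : ((a * b) (X ^ k)).coeff i ≠ 0 := by
    have hbj : (b (X ^ k)).coeff j ≠ 0 := (h2 j).2 (by rwa [show (j : ℤ) - k = r by omega])
    rw [Module.End.mul_apply, coeff_apply, Finset.sum_eq_single_of_mem j (mem_support_iff.2 hbj)]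
    · exact mul_ne_zero hbj ((h1 r hr j hj.symm i).2 (by rwa [show (i : ℤ) - j = q by omega]))
    · intro l hl hlj
      have hl' := (h2 l).1 (mem_support_iff.1 hl)
      by_contra hc
      have hc' := (h1 _ hl' l (by omega) i).1 (right_ne_zero_of_mul hc)
      have := huniq _ hc' _ hl' (by omega)
      omega
  rw [hX, coeff_X_pow] at hne
  have : i = k := by by_contra h; simp [h] at hne
  omega

/-- As for units of a Laurent polynomial ring: the sum of the two maxima and the sum of the two
minima are each attained only once, so both vanish, which forces each set to have equal maximum and
minimum. -/
theorem HasShifts.eq_singleton {a b : EndP K} {s t : Finset ℤ} (ha : HasShifts a s)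
    (hb : HasShifts b t) (hab : a * b - 1 ∈ F K) (hs : s.Nonempty) (ht : t.Nonempty) :
    ∃ n, s = {-n} ∧ t = {n} := by
  have hmax := ha.add_eq_zero hb hab (s.max'_mem hs) (t.max'_mem ht) fun n hn m hm e => by
    have := s.le_max' n hn
    have := t.le_max' m hm
    omega
  have hmin := ha.add_eq_zero hb hab (s.min'_mem hs) (t.min'_mem ht) fun n hn m hm e => by
    have := s.min'_le n hn
    have := t.min'_le m hm
    omega
  have h1 := s.min'_le _ (s.max'_mem hs)
  have h2 := t.min'_le _ (t.max'_mem ht)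
  refine ⟨t.max' ht, ?_, ?_⟩
  · refine Finset.eq_singleton_iff_nonempty_unique_mem.2 ⟨hs, fun n hn => ?_⟩
    have := s.le_max' n hn
    have := s.min'_le n hn
    omega
  · refine Finset.eq_singleton_iff_nonempty_unique_mem.2 ⟨ht, fun n hn => ?_⟩
    have := t.le_max' n hn
    have := t.min'_le n hn
    omega

theorem one_notMem_F : (1 : EndP K) ∉ F K := by
  intro h
  obtain ⟨N, hN⟩ := mem_F_iff.1 h
  have := hN N le_rfl
  simp at this

/-- An element of `𝔸₁` with a left inverse modulo `F` acts on monomials of large degree as a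
shift times the product of a scalar with an element of `𝓗`. -/
theorem exists_shift_of_mul_sub_one_mem_F {a b : EndP K} (ha : a ∈ A1 K) (hb : b ∈ A1 K)
    (hab : a * b - 1 ∈ F K) : ∃ (c : Kˣ) (u : calH K) (n : ℤ), ∀ᶠ k : ℕ in Filter.atTop,
      ∀ m : ℕ, (m : ℤ) = k + n →
        b (X ^ k) = ((c * eigen K u k : Kˣ) : K) • (X ^ m : K[X]) := by
  obtain ⟨s, g, h, hh, hg, H⟩ := exists_normal_form ha
  obtain ⟨t, g', h', hh', hg', H'⟩ := exists_normal_form hb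
  have shifts {a : EndP K} {s : Finset ℤ} {g h : ℤ → K[X]} (hh : ∀ n, h n ∈ intSplit K)
      (hg : ∀ n ∈ s, g n ≠ 0) (H : ∀ᶠ k : ℕ in Filter.atTop, ∀ m : ℕ, (a (X ^ k)).coeff m =
        if (m : ℤ) - k ∈ s then (g (m - k)).eval (k : K) / (h (m - k)).eval (k : K) else 0) :
      HasShifts a s := by
    have h1 : ∀ᶠ k : ℕ in Filter.atTop, ∀ n ∈ s, (h n).eval (k : K) ≠ 0 ∧
        (g n).eval (k : K) ≠ 0 := (Filter.eventually_all_finset s).2 fun n hn =>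
      (eventually_eval_ne_zero (ne_zero_of_mem_intSplit (hh n))).and
        (eventually_eval_ne_zero (hg n hn))
    filter_upwards [H, h1] with k hk hk1 m
    rw [hk]
    split_ifs with hm
    · simp [hm, hk1 _ hm]
    · simp [hm]
  have sa := shifts hh hg H
  have sb := shifts hh' hg' H'
  have emp {a : EndP K} (ha : HasShifts a ∅) : a ∈ F K := by
    obtain ⟨N, hN⟩ := Filter.eventually_atTop.1 ha
    refine mem_F_iff.2 ⟨N, fun k hk => Polynomial.ext fun m => ?_⟩
    simpa using hN k hk m
  have h1 : a * b ∉ F K := fun hc => one_notMem_F (by simpa using sub_mem hc hab)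
  have hs : s.Nonempty := by
    rw [Finset.nonempty_iff_ne_empty]
    rintro rfl
    exact h1 (mul_mem_F_right (emp sa) hb)
  have ht : t.Nonempty := by
    rw [Finset.nonempty_iff_ne_empty]
    rintro rfl
    exact h1 (mul_mem_F_left _ (emp sb))
  obtain ⟨n, rfl, rfl⟩ := sa.eq_singleton sb hab hs ht
  have monomial {a : EndP K} {n : ℤ} {g h : ℤ → K[X]}
      (H : ∀ᶠ k : ℕ in Filter.atTop, ∀ m : ℕ, (a (X ^ k)).coeff m =
        if (m : ℤ) - k ∈ ({n} : Finset ℤ) then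
          (g (m - k)).eval (k : K) / (h (m - k)).eval (k : K) else 0) :
      ∀ᶠ k : ℕ in Filter.atTop, ∀ m : ℕ, (m : ℤ) = k + n →
        a (X ^ k) = ((g n).eval (k : K) / (h n).eval (k : K)) • (X ^ m : K[X]) := by
    filter_upwards [H] with k hk m hm
    refine Polynomial.ext fun i => ?_
    rw [hk, coeff_smul, coeff_X_pow, smul_eq_mul, mul_ite, mul_one, mul_zero]
    by_cases hi : i = m
    · subst hi
      rw [show (i : ℤ) - k = n by omega]
      simp
    · rw [if_neg hi, if_neg]
      rw [Finset.mem_singleton]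
      omega
  have ma := monomial H
  have mb := monomial H'
  -- For large `k` the coefficient of `b` at `k` times that of `a` at `k + n` is `1`; clearing
  -- denominators gives a polynomial identity, valid at infinitely many points.
  have hpoly : g' n * (g (-n)).comp (X + C (n : K)) = h' n * (h (-n)).comp (X + C (n : K)) := by
    refine eq_of_eventually_eval_eq ?_
    obtain ⟨N, hN⟩ := mem_F_iff.1 hab
    filter_upwards [mb, eventually_natCast_add n ma, Filter.eventually_ge_atTop (N + n.natAbs),
      eventually_eval_ne_zero (ne_zero_of_mem_intSplit (hh' n)),
      eventually_natCast_add n (eventually_eval_ne_zero (ne_zero_of_mem_intSplit (hh (-n))))]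
      with k e1 e2 e3 e4 e5
    obtain ⟨j, hj⟩ := Int.eq_ofNat_of_zero_le (show 0 ≤ (k : ℤ) + n by omega)
    have hj' : (k : K) + (n : K) = (j : K) := by exact_mod_cast congrArg (Int.cast (R := K)) hj
    have hX := hN k (by omega)
    rw [LinearMap.sub_apply, Module.End.one_apply, Module.End.mul_apply, e1 j hj.symm, map_smul,
      e2 j hj.symm k (by omega), smul_smul, sub_eq_zero] at hX
    have h2 := congrArg (fun p => coeff p k) hX
    simp only [coeff_smul, coeff_X_pow, smul_eq_mul, if_true, mul_one] at h2
    simp only [eval_mul, eval_comp, eval_add, eval_X, eval_C, hj']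
    have e6 := e5 j hj.symm
    field_simp at h2
    linear_combination h2
  -- The numerator of `b` divides a product of factors `X + i`, hence is itself such a product up to
  -- a scalar. Numerator and denominator then both come from `𝓗`.
  obtain ⟨c, q, hq, hgq⟩ := exists_eq_C_mul_of_dvd
    (mul_mem (hh' n) (comp_mem_intSplit (hh (-n)) n)) (Dvd.intro _ hpoly)
  obtain ⟨u, hu, hu'⟩ := exists_eigen_eq hq
  obtain ⟨v, hv, hv'⟩ := exists_eigen_eq (hh' n)
  refine ⟨c, ⟨u / v, div_mem hu hv⟩, n, ?_⟩
  filter_upwards [mb, hu', hv'] with k e1 e2 e3 m hm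
  rw [e1 m hm, hgq, eval_mul, eval_C, ← e2, ← e3]
  congr 1
  simp only [_root_.map_div, Pi.div_apply, Units.val_mul, Units.val_div_eq_div_val]
  ring


/-! ### Codimension, and the image of `x` under an automorphism -/

variable (K) in
/-- The multiples of `x^M`. -/
def tail (M : ℕ) : Submodule K K[X] := (Ideal.span {(X ^ M : K[X])}).restrictScalars K

theorem tail_eq_span (M : ℕ) :
    tail K M = Submodule.span K (Set.range fun i : ℕ => (X ^ (M + i) : K[X])) := by
  refine le_antisymm (fun p hp => ?_) (Submodule.span_le.2 ?_)
  · obtain ⟨q, rfl⟩ := Ideal.mem_span_singleton.1 hp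
    rw [q.as_sum_support_C_mul_X_pow, Finset.mul_sum]
    refine sum_mem fun i _ => ?_
    rw [mul_left_comm, ← pow_add, ← smul_eq_C_mul]
    exact Submodule.smul_mem _ _ (Submodule.subset_span ⟨i, rfl⟩)
  · rintro _ ⟨i, rfl⟩
    exact Ideal.mem_span_singleton.2 (pow_dvd_pow _ (Nat.le_add_right _ _))

theorem map_tail {T : EndP K} {M M' : ℕ} (r : ℕ → Kˣ)
    (h : ∀ i, T (X ^ (M + i)) = (r i : K) • (X ^ (M' + i) : K[X])) :
    (tail K M).map T = tail K M' := by
  rw [tail_eq_span, tail_eq_span, Submodule.map_span]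
  refine le_antisymm (Submodule.span_le.2 ?_) (Submodule.span_le.2 ?_)
  · rintro _ ⟨_, ⟨i, rfl⟩, rfl⟩
    simp only [h]
    exact Submodule.smul_mem _ _ (Submodule.subset_span ⟨i, rfl⟩)
  · rintro _ ⟨i, rfl⟩
    have h1 : (X ^ (M' + i) : K[X]) = (((r i)⁻¹ : Kˣ) : K) • T (X ^ (M + i)) := by
      rw [h, smul_smul, Units.inv_mul, one_smul]
    simp only [h1]
    exact Submodule.smul_mem _ _ (Submodule.subset_span ⟨_, ⟨i, rfl⟩, rfl⟩)

/-- The codimension of a subspace of `K[x]`. -/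
def codim (U : Submodule K K[X]) : ℕ := Module.finrank K (K[X] ⧸ U)

theorem codim_tail (M : ℕ) : codim (tail K M) = M := by
  have h := (Submodule.Quotient.restrictScalarsEquiv K (Ideal.span {(X ^ M : K[X])})).finrank_eq
  refine h.trans ?_
  have h2 := finrank_quotient_span_eq_natDegree (K := K) (f := X ^ M)
  rwa [natDegree_X_pow] at h2

theorem finite_quotient_tail (M : ℕ) : Module.Finite K (K[X] ⧸ tail K M) := by
  have : Module.Finite K (K[X] ⧸ Ideal.span {(X ^ M : K[X])}) :=
    (monic_X_pow M).finite_quotient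
  exact Module.Finite.equiv (Submodule.Quotient.restrictScalarsEquiv K _).symm

/-- The isomorphism of quotients induced by an invertible operator. -/
def quotMapEquiv (φ : (EndP K)ˣ) (U : Submodule K K[X]) :
    (K[X] ⧸ U) ≃ₗ[K] K[X] ⧸ U.map (φ : EndP K) :=
  Submodule.Quotient.equiv _ _ (LinearMap.GeneralLinearGroup.toLinearEquiv φ) rfl

theorem codim_map_unit (φ : (EndP K)ˣ) (U : Submodule K K[X]) :
    codim (U.map (φ : EndP K)) = codim U :=
  (quotMapEquiv φ U).finrank_eq.symm

/-- The map `p ↦ (y p mod U, p(0))` is onto `K[x]/U × K` with kernel `x U`. Finiteness matters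
because `Module.finrank` is `0` on infinite-dimensional spaces. -/
theorem codim_map_opX (U : Submodule K K[X]) [Module.Finite K (K[X] ⧸ U)] :
    codim (U.map (opX K)) = codim U + 1 := by
  let f : K[X] →ₗ[K] (K[X] ⧸ U) × K := (U.mkQ.comp (opY K)).prod (lcoeff K 0)
  have hyx (p : K[X]) : opY K (opX K p) = p := by
    have h : opY K * opX K = 1 := end_ext fun k => by simp
    exact LinearMap.congr_fun h p
  have hxc (p : K[X]) : (opX K p).coeff 0 = 0 := by simp [opX]
  have hxy (p : K[X]) : opX K (opY K p) + C (p.coeff 0) = p := by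
    have h : opX K * opY K + E K 0 0 = 1 := by simp [E]
    have h2 := LinearMap.congr_fun h p
    rw [LinearMap.add_apply, E_apply, pow_zero, smul_eq_C_mul, mul_one] at h2
    exact h2
  have hf : Function.Surjective f := by
    rintro ⟨q, c⟩
    obtain ⟨q, rfl⟩ := U.mkQ_surjective q
    refine ⟨opX K q + C c, ?_⟩
    have h0 : opY K (C c) = 0 := by
      rw [← mul_one (C c), ← smul_eq_C_mul, map_smul, opY_zero, smul_zero]
    simp [f, hyx, hxc, h0]
  have hker : LinearMap.ker f = U.map (opX K) := by
    ext p
    constructor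
    · intro hp
      have h1 : opY K p ∈ U ∧ p.coeff 0 = 0 := by simpa [f] using hp
      refine ⟨opY K p, h1.1, ?_⟩
      have := hxy p
      rwa [h1.2, C_0, add_zero] at this
    · rintro ⟨q, hq, rfl⟩
      have hq' : q ∈ U := hq
      simp [f, hyx, hxc, hq']
  have h := (LinearMap.quotKerEquivOfSurjective f hf).finrank_eq
  rw [hker, Module.finrank_prod, Module.finrank_self] at h
  exact h

/-- The element `x` of `𝔸₁`. -/
def xA : A1 K := ⟨opX K, opX_mem_A1⟩

/-- The element `y` of `𝔸₁`. -/
def yA : A1 K := ⟨opY K, opY_mem_A1⟩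

theorem yA_mul_xA : (yA : A1 K) * xA = 1 := by
  ext1
  exact end_ext fun k => by simp [yA, xA]

/-- The image of `x` under an automorphism of `𝔸₁`, on monomials of large degree. -/
theorem exists_map_xA (σ : G1 K) : ∃ (c : Kˣ) (u : calH K), ∀ᶠ k : ℕ in Filter.atTop,
    (σ xA : EndP K) (X ^ k) = ((c * eigen K u k : Kˣ) : K) • (X ^ (k + 1) : K[X]) := by
  have h1 : (σ yA : EndP K) * σ xA - 1 ∈ F K := by
    rw [← MulMemClass.coe_mul, ← map_mul, yA_mul_xA, map_one, OneMemClass.coe_one, sub_self]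
    exact zero_mem _
  obtain ⟨c, u, n, H⟩ := exists_shift_of_mul_sub_one_mem_F (σ yA).2 (σ xA).2 h1
  obtain ⟨φ, hφ⟩ := exists_conj σ
  refine ⟨c, u, ?_⟩
  -- An index argument: `σ(x)` carries the multiples of `x^M` onto those of `x^(M+n)`, raising
  -- codimension by `n`, while `σ(x) = φ x φ⁻¹` raises every finite codimension by `1`.
  suffices hn : n = 1 by
    subst hn
    filter_upwards [H] with k hk
    exact hk _ (by push_cast; ring)
  obtain ⟨N, hN⟩ := Filter.eventually_atTop.1 H
  -- Adding `|n|` to the threshold keeps the target degree `M + n` nonnegative.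
  obtain ⟨M', hM'⟩ := Int.eq_ofNat_of_zero_le (show 0 ≤ ((N + n.natAbs : ℕ) : ℤ) + n by omega)
  set M := N + n.natAbs with hM
  have hT : (tail K M).map (σ xA : EndP K) = tail K M' :=
    map_tail (fun i => c * eigen K u (M + i)) fun i => hN _ (by omega) _ (by push_cast; omega)
  have hT2 : (tail K M').map ((φ⁻¹ : (EndP K)ˣ) : EndP K) =
      ((tail K M).map ((φ⁻¹ : (EndP K)ˣ) : EndP K)).map (opX K) := by
    rw [← hT, ← Submodule.map_comp, ← Submodule.map_comp]
    congr 1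
    change ((φ⁻¹ : (EndP K)ˣ) : EndP K) * (σ xA : EndP K) = opX K * ((φ⁻¹ : (EndP K)ˣ) : EndP K)
    rw [hφ, mul_assoc (φ : EndP K), Units.inv_mul_cancel_left]
    rfl
  have hfin : Module.Finite K (K[X] ⧸ (tail K M).map ((φ⁻¹ : (EndP K)ˣ) : EndP K)) :=
    have := finite_quotient_tail (K := K) M
    Module.Finite.equiv (quotMapEquiv φ⁻¹ _)
  have h2 := congrArg codim hT2
  rw [codim_map_opX, codim_map_unit, codim_map_unit, codim_tail, codim_tail] at h2
  omega

/-! ### Automorphisms fixing `x` modulo `F`, and the factorization of `𝔾₁` -/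

theorem map_sub_mem_F (σ : G1 K) {a b : A1 K} (h : (a : EndP K) - b ∈ F K) :
    (σ a : EndP K) - σ b ∈ F K := by
  have h1 : ((a + (-1 : K) • b : A1 K) : EndP K) = a - b := by
    simp [sub_eq_add_neg]
  have h2 := map_mem_F σ (h1 ▸ h)
  rw [map_add, map_smul] at h2
  simpa [sub_eq_add_neg] using h2

/-- An operator commuting with `x` on high monomials is `K[x]`-linear on the ideal generated by
`x^N`. -/
theorem apply_X_pow_mul {T : EndP K} {N : ℕ}
    (h : ∀ k ≥ N, T (X ^ (k + 1)) = X * T (X ^ k)) (q : K[X]) :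
    T (X ^ N * q) = T (X ^ N) * q := by
  have h1 (i : ℕ) : T (X ^ (N + i)) = T (X ^ N) * X ^ i := by
    induction i with
    | zero => simp
    | succ i ih => rw [← add_assoc, h _ (by omega), ih, pow_succ]; ring
  have h2 : T.comp (LinearMap.mulLeft K (X ^ N)) = LinearMap.mulLeft K (T (X ^ N)) :=
    end_ext fun i => by simp [← pow_add, h1]
  exact LinearMap.congr_fun h2 q

theorem omegaGL_apply (v : GLInf K) (a : A1 K) : (omegaGL K v a : EndP K) =
    ((v : onePlusF K) : EndP K) * a * ((v⁻¹ : GLInf K) : onePlusF K) := rfl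

/-- An automorphism of `𝔸₁` that fixes `x` modulo `F` is inner, given by an element of
`GL_∞(K)`. -/
theorem exists_eq_omegaGL {σ : G1 K} (hσ : (σ xA : EndP K) - opX K ∈ F K) :
    ∃ v : GLInf K, σ = omegaGL K v := by
  obtain ⟨φ, hφ⟩ := exists_conj σ
  -- Since `σ⁻¹` also preserves `F`, it too fixes `x` modulo `F`; this makes `φ`, and not only
  -- `φ⁻¹`, commute with `x` on high monomials.
  have hsymm : (((φ⁻¹ : (EndP K)ˣ) : EndP K) * opX K * φ) - opX K ∈ F K := by
    have h1 := map_sub_mem_F (b := xA) σ.symm hσ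
    rw [σ.symm_apply_apply] at h1
    have h2 : (σ.symm xA : EndP K) = ((φ⁻¹ : (EndP K)ˣ) : EndP K) * opX K * φ := by
      have h3 := hφ (σ.symm xA)
      rw [σ.apply_symm_apply] at h3
      change opX K = _ at h3
      rw [h3]
      simp [mul_assoc]
    rw [← h2, ← neg_sub]
    exact neg_mem h1
  rw [hφ] at hσ
  obtain ⟨N₁, hN₁⟩ := mem_F_iff.1 hσ
  obtain ⟨N₂, hN₂⟩ := mem_F_iff.1 hsymm
  obtain ⟨N, hN, hN'⟩ : ∃ N, N₁ ≤ N ∧ N₂ ≤ N := ⟨max N₁ N₂, le_max_left _ _, le_max_right _ _⟩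
  have rec_of {ψ : (EndP K)ˣ} {M : ℕ} (h : ∀ k ≥ M,
      ((ψ : EndP K) * opX K * ((ψ⁻¹ : (EndP K)ˣ) : EndP K) - opX K) (X ^ k) = 0) {k : ℕ}
      (hk : M ≤ k) : ((ψ⁻¹ : (EndP K)ˣ) : EndP K) (X ^ (k + 1)) =
        X * ((ψ⁻¹ : (EndP K)ˣ) : EndP K) (X ^ k) := by
    have h1 := h k hk
    rw [LinearMap.sub_apply, sub_eq_zero, opX_pow] at h1
    rw [← h1, ← Module.End.mul_apply, ← mul_assoc, Units.inv_mul_cancel_left]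
    rfl
  have hinv (q : K[X]) : ((φ⁻¹ : (EndP K)ˣ) : EndP K) (X ^ N * q) =
      ((φ⁻¹ : (EndP K)ˣ) : EndP K) (X ^ N) * q :=
    apply_X_pow_mul (fun k hk => rec_of hN₁ (hN.trans hk)) q
  have hdir (q : K[X]) : (φ : EndP K) (X ^ N * q) = (φ : EndP K) (X ^ N) * q :=
    apply_X_pow_mul (fun k hk => by
      have := rec_of (ψ := φ⁻¹) (M := N₂) (by simpa using hN₂) (hN'.trans hk)
      simpa using this) q
  set t := ((φ⁻¹ : (EndP K)ˣ) : EndP K) (X ^ N) with ht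
  -- With `t = φ⁻¹(x^N)`, linearity in both directions gives `φ(x^N) t = φ(x^N t) = φ(φ⁻¹(x^(2N))) =
  -- x^(2N)`. Hence `φ(x^N)` divides a power of `x`, and is a scalar times some `x^j`.
  have htt : (φ : EndP K) (X ^ N) * t = X ^ (2 * N) := by
    rw [← hdir, mul_comm, ← hinv, ← Module.End.mul_apply, Units.mul_inv, two_mul, pow_add]
    rfl
  obtain ⟨j, -, hj⟩ := (dvd_prime_pow (prime_X (R := K)) _).1 (Dvd.intro _ htt)
  obtain ⟨w, hw⟩ := hj.symm
  obtain ⟨c, hc, hcw⟩ := Polynomial.isUnit_iff.1 w.isUnit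
  have hφN (i : ℕ) : (φ : EndP K) (X ^ (N + i)) = ((hc.unit : Kˣ) : K) • (X ^ (j + i) : K[X]) := by
    rw [pow_add, hdir, ← hw, ← hcw, smul_eq_C_mul, IsUnit.unit_spec, pow_add]
    ring
  -- The invertible `φ` preserves codimension and maps the multiples of `x^N` onto those of `x^j`.
  have hNj : N = j := by
    have h1 := codim_map_unit φ (tail K N)
    rw [map_tail _ hφN, codim_tail, codim_tail] at h1
    exact h1.symm
  subst hNj
  set d : Kˣ := hc.unit
  have hφk (k : ℕ) (hk : N ≤ k) : (φ : EndP K) (X ^ k) = (d : K) • (X ^ k : K[X]) := by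
    obtain ⟨i, rfl⟩ := Nat.exists_eq_add_of_le hk
    exact hφN i
  have hφk' (k : ℕ) (hk : N ≤ k) : ((φ⁻¹ : (EndP K)ˣ) : EndP K) (X ^ k) =
      ((d⁻¹ : Kˣ) : K) • (X ^ k : K[X]) := by
    have h1 : (X ^ k : K[X]) = (φ : EndP K) (((d⁻¹ : Kˣ) : K) • (X ^ k : K[X])) := by
      rw [map_smul, hφk k hk, smul_smul, Units.inv_mul, one_smul]
    conv_lhs => rw [h1]
    rw [← Module.End.mul_apply, Units.inv_mul, Module.End.one_apply]
  -- On high monomials `φ` is the scalar `d`, so `d⁻¹ φ` lies in `1 + F`; rescaling does not change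
  -- the conjugation.
  refine ⟨⟨⟨((d⁻¹ : Kˣ) : K) • (φ : EndP K), mem_F_iff.2 ⟨N, fun k hk => ?_⟩⟩,
    ⟨(d : K) • ((φ⁻¹ : (EndP K)ˣ) : EndP K), mem_F_iff.2 ⟨N, fun k hk => ?_⟩⟩, ?_, ?_⟩, ?_⟩
  · rw [LinearMap.sub_apply, LinearMap.smul_apply, hφk k hk, smul_smul, Units.inv_mul, one_smul,
      Module.End.one_apply, sub_self]
  · rw [LinearMap.sub_apply, LinearMap.smul_apply, hφk' k hk, smul_smul, Units.mul_inv, one_smul,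
      Module.End.one_apply, sub_self]
  · ext1
    simp [smul_smul]
  · ext1
    simp [smul_smul]
  · refine AlgEquiv.ext fun a => Subtype.ext ?_
    rw [hφ, omegaGL_apply]
    change _ = (((d⁻¹ : Kˣ) : K) • (φ : EndP K)) * a * ((d : K) • ((φ⁻¹ : (EndP K)ˣ) : EndP K))
    rw [smul_mul_assoc, smul_mul_assoc, mul_smul_comm, smul_smul, Units.inv_mul, one_smul]

theorem eigen_scalarUnit (c : Kˣ) : eigen K (scalarUnit K c) = fun _ => c := by
  refine diagUnit_injective (Units.ext ?_)
  rw [diagUnit_eigen]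
  refine end_ext fun k => ?_
  rw [diagUnit_pow]
  rfl

theorem twist_xA_pow (u : diagUnits K) (k : ℕ) :
    (twist K u xA : EndP K) (X ^ k) = (eigen K u k : K) • (X ^ (k + 1) : K[X]) := by
  have h : (twist K u xA : EndP K) = opX K * (((u : (A1 K)ˣ) : A1 K) : EndP K) :=
    congrArg Subtype.val (twist_x u)
  rw [h, ← diagUnit_eigen, Module.End.mul_apply, diagUnit_pow, map_smul, opX_pow]

theorem torus_mul_mu (c : Kˣ) (u : calH K) :
    torus K c * mu K u = twist K (scalarUnit K c * u) := (map_mul (twist K) _ _).symm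

/-- The asymptotic form of `σ(x)` determines `λ` and `u` such that `τ = t_λ μ_u` agrees with `σ` on
`x` modulo `F`. Then `τ⁻¹ σ` fixes `x` modulo `F`. -/
theorem exists_eq_torus_mul_mu_mul_omegaGL (σ : G1 K) :
    ∃ (c : Kˣ) (u : calH K) (v : GLInf K), σ = torus K c * mu K u * omegaGL K v := by
  obtain ⟨c, u, H⟩ := exists_map_xA σ
  set τ := torus K c * mu K u with hτ
  have h1 : (σ xA : EndP K) - τ xA ∈ F K := by
    obtain ⟨N, hN⟩ := Filter.eventually_atTop.1 H
    refine mem_F_iff.2 ⟨N, fun k hk => ?_⟩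
    rw [LinearMap.sub_apply, hN k hk, hτ, torus_mul_mu, twist_xA_pow, map_mul, eigen_scalarUnit,
      Pi.mul_apply, sub_self]
  have h2 : ((τ⁻¹ * σ) xA : EndP K) - opX K ∈ F K := by
    have h3 := map_sub_mem_F τ.symm h1
    rw [τ.symm_apply_apply] at h3
    exact h3
  obtain ⟨v, hv⟩ := exists_eq_omegaGL h2
  exact ⟨c, u, v, by rw [← hv, mul_inv_cancel_left]⟩


/-! ### The normal subgroup of the `ω_v` and its identification with `Inn(𝕊₁)` -/

/-- Evaluating at `1`, where `E_{i0}` gives `x^i`: `T x^i = E_{i0}(T 1)`, a multiple of `x^i` by a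
constant independent of `i`. -/
theorem exists_eq_smul_one_of_commute {T : EndP K} (h : ∀ i, T * E K i 0 = E K i 0 * T) :
    ∃ c : K, T = c • (1 : EndP K) := by
  refine ⟨(T 1).coeff 0, end_ext fun i => ?_⟩
  have h1 := LinearMap.congr_fun (h i) 1
  rw [Module.End.mul_apply, Module.End.mul_apply, E_apply, E_apply, coeff_one_zero, one_smul] at h1
  rw [h1, LinearMap.smul_apply, Module.End.one_apply]

/-- Two operators of `1 + F` that induce the same conjugation on `𝔸₁` agree. -/
theorem eq_of_conj_eq {v w : EndP K} {v' w' : EndP K} (hv : v - 1 ∈ F K) (hw : w - 1 ∈ F K)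
    (hv' : v' * v = 1) (hw' : w' * w = 1) (hw'' : w * w' = 1)
    (h : ∀ a : A1 K, v * a * v' = w * a * w') : v = w := by
  obtain ⟨c, hc⟩ := exists_eq_smul_one_of_commute (T := w' * v) fun i => by
    have h1 := h (matUnit i 0)
    change v * E K i 0 * v' = w * E K i 0 * w' at h1
    calc w' * v * E K i 0 = w' * (v * E K i 0 * v') * v := by simp only [mul_assoc, hv', mul_one]
      _ = E K i 0 * (w' * v) := by rw [h1]; simp only [← mul_assoc, hw', one_mul]
  have hvw : v = c • w := by
    calc v = w * (w' * v) := by rw [← mul_assoc, hw'', one_mul]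
      _ = c • w := by rw [hc, mul_smul_comm, mul_one]
  -- The two operators differ by a scalar `c`; both fix a monomial of large degree, so `c = 1`.
  obtain ⟨N, hN⟩ := mem_F_iff.1 hv
  obtain ⟨M, hM⟩ := mem_F_iff.1 hw
  have e1 := hN (N + M) (by omega)
  have e2 := hM (N + M) (by omega)
  rw [LinearMap.sub_apply, Module.End.one_apply, sub_eq_zero] at e1 e2
  rw [hvw, LinearMap.smul_apply, e2] at e1
  have e3 := congrArg (fun p => coeff p (N + M)) e1
  simp only [coeff_smul, coeff_X_pow, if_true, smul_eq_mul, mul_one] at e3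
  rw [hvw, e3, one_smul]

theorem coe_inv_mul (v : GLInf K) :
    (((v⁻¹ : GLInf K) : onePlusF K) : EndP K) * ((v : onePlusF K) : EndP K) = 1 :=
  congrArg Subtype.val v.inv_mul

theorem coe_mul_inv (v : GLInf K) :
    ((v : onePlusF K) : EndP K) * (((v⁻¹ : GLInf K) : onePlusF K) : EndP K) = 1 :=
  congrArg Subtype.val v.mul_inv

theorem GLInf_ext {v w : GLInf K} (h : ((v : onePlusF K) : EndP K) = ((w : onePlusF K) : EndP K)) :
    v = w := Units.ext (Subtype.ext h)

theorem omegaGL_injective : Function.Injective (omegaGL K) := by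
  intro v w h
  refine GLInf_ext (eq_of_conj_eq v.1.2 w.1.2 (coe_inv_mul v) (coe_inv_mul w) (coe_mul_inv w) ?_)
  intro a
  rw [← omegaGL_apply, ← omegaGL_apply, h]

theorem opX_mul_opY : opX K * opY K = 1 - E K 0 0 := by simp [E]

theorem opY_mul_opX : opY K * opX K = 1 := end_ext fun k => by simp

/-- The defect `yx - xy = E₀₀` lies in `F`, so `x` is central in `𝕊₁` modulo `F`. Inner
automorphisms of `𝕊₁` therefore fix `x` modulo `F`. -/
theorem commutator_opX_mem_F {a : EndP K} (ha : a ∈ S1 K) : a * opX K - opX K * a ∈ F K := by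
  induction ha using Algebra.adjoin_induction with
  | mem b hb =>
    rcases hb with rfl | rfl
    · rw [sub_self]
      exact zero_mem _
    · rw [opX_mul_opY, opY_mul_opX, sub_sub_cancel]
      exact E_mem_F 0 0
  | algebraMap r =>
    rw [Algebra.commutes, sub_self]
    exact zero_mem _
  | add a b _ _ ha hb =>
    have h : (a + b) * opX K - opX K * (a + b) =
        (a * opX K - opX K * a) + (b * opX K - opX K * b) := by
      rw [mul_add, add_mul]; abel
    rw [h]
    exact add_mem ha hb
  | mul a b _ hb' ha hb =>
    have h : a * b * opX K - opX K * (a * b) =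
        a * (b * opX K - opX K * b) + (a * opX K - opX K * a) * b := by
      simp only [mul_sub, sub_mul, mul_assoc]; abel
    rw [h]
    exact add_mem (mul_mem_F_left _ hb) (mul_mem_F_right ha (S1_le_A1 hb'))

theorem innerAut_apply {A : Type*} [Ring A] [Algebra K A] (u : Aˣ) (a : A) :
    innerAut K A u a = u * a * (u⁻¹ : Aˣ) := rfl

theorem innerAut_S1_apply (u : (S1 K)ˣ) (a : S1 K) : (innerAut K (S1 K) u a : EndP K) =
    ((u : S1 K) : EndP K) * a * ((u⁻¹ : (S1 K)ˣ) : S1 K) := by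
  rw [innerAut_apply, MulMemClass.coe_mul, MulMemClass.coe_mul]

theorem omegaS1_apply (u : (S1 K)ˣ) (a : A1 K) : (omegaS1 K u a : EndP K) =
    ((u : S1 K) : EndP K) * a * ((u⁻¹ : (S1 K)ˣ) : S1 K) := by
  rw [omegaS1, MonoidHom.comp_apply, innerAut_apply, ← map_inv, MulMemClass.coe_mul,
    MulMemClass.coe_mul]
  rfl

theorem omegaS1_xA_sub_mem_F (u : (S1 K)ˣ) : (omegaS1 K u xA : EndP K) - opX K ∈ F K := by
  have h1 : ((u : S1 K) : EndP K) * ((u⁻¹ : (S1 K)ˣ) : S1 K) = 1 := congrArg Subtype.val u.mul_inv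
  have h2 : (omegaS1 K u xA : EndP K) - opX K =
      (((u : S1 K) : EndP K) * opX K - opX K * (u : S1 K)) * ((u⁻¹ : (S1 K)ˣ) : S1 K) := by
    rw [omegaS1_apply, sub_mul, mul_assoc (opX K), h1, mul_one]
    rfl
  rw [h2]
  exact mul_mem_F_right (commutator_opX_mem_F (SetLike.coe_mem _))
    (S1_le_A1 (SetLike.coe_mem _))

theorem range_omegaGL : (omegaGL K).range = innS1 K := by
  refine le_antisymm ?_ ?_
  · rintro _ ⟨v, rfl⟩
    exact ⟨_, rfl⟩
  · rintro _ ⟨u, rfl⟩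
    obtain ⟨v, hv⟩ := exists_eq_omegaGL (omegaS1_xA_sub_mem_F u)
    exact ⟨v, hv.symm⟩

theorem omegaGL_xA_sub_mem_F (v : GLInf K) : (omegaGL K v xA : EndP K) - opX K ∈ F K :=
  omegaS1_xA_sub_mem_F _

theorem omegaGL_sub_mem_F (v : GLInf K) (a : A1 K) : (omegaGL K v a : EndP K) - a ∈ F K := by
  have h : (omegaGL K v a : EndP K) - a = ((((v : onePlusF K) : EndP K) - 1) * a -
      a * (((v : onePlusF K) : EndP K) - 1)) * ((v⁻¹ : GLInf K) : onePlusF K) := by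
    have h1 : (((v : onePlusF K) : EndP K) - 1) * a - a * (((v : onePlusF K) : EndP K) - 1) =
      ((v : onePlusF K) : EndP K) * a - a * ((v : onePlusF K) : EndP K) := by
      simp only [mul_sub, sub_mul, mul_one, one_mul]; abel
    rw [h1, sub_mul, mul_assoc (a : EndP K), coe_mul_inv, mul_one, omegaGL_apply]
  rw [h]
  have hv : ((v : onePlusF K) : EndP K) - 1 ∈ F K := v.1.2
  have hv' : (((v⁻¹ : GLInf K) : onePlusF K) : EndP K) - 1 ∈ F K := (v⁻¹).1.2
  refine mul_mem_F_right (sub_mem (mul_mem_F_right hv a.2) (mul_mem_F_left _ hv)) ?_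
  simpa using add_mem (F_le_A1 hv') (one_mem (A1 K))

/-- The subgroup `{ω_v | v ∈ GL_∞(K)}` is normal. -/
theorem exists_conj_omegaGL (σ : G1 K) (v : GLInf K) :
    ∃ w : GLInf K, omegaGL K w = σ * omegaGL K v * σ⁻¹ := by
  -- The automorphism `ω_v` is the identity modulo `F` and `σ` preserves `F`, so the conjugate of
  -- `ω_v` also fixes `x` modulo `F`.
  have h := map_sub_mem_F σ (omegaGL_sub_mem_F v (σ⁻¹ xA))
  have h1 : σ (σ⁻¹ xA) = xA := σ.apply_symm_apply xA
  rw [h1] at h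
  obtain ⟨w, hw⟩ := exists_eq_omegaGL (σ := σ * omegaGL K v * σ⁻¹) h
  exact ⟨w, hw.symm⟩

theorem normal_range_omegaGL : (omegaGL K).range.Normal := by
  refine ⟨?_⟩
  rintro _ ⟨v, rfl⟩ σ
  obtain ⟨w, hw⟩ := exists_conj_omegaGL σ v
  exact ⟨w, hw⟩

variable (K) in
-- A unit commuting with the matrix units, which already lie in `𝕊₁`, is a scalar, and scalars are
-- central in `𝔸₁` too. Equality of the kernels is what makes extending `ω_u` from `𝕊₁` to `𝔸₁` well
-- defined and injective.
theorem ker_innerAut_S1 : (innerAut K (S1 K)).ker = (omegaS1 K).ker := by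
  ext u
  have h1 : ((u : S1 K) : EndP K) * ((u⁻¹ : (S1 K)ˣ) : S1 K) = 1 := congrArg Subtype.val u.mul_inv
  have h2 : (((u⁻¹ : (S1 K)ˣ) : S1 K) : EndP K) * (u : S1 K) = 1 := congrArg Subtype.val u.inv_mul
  constructor
  · intro h
    obtain ⟨c, hc⟩ := exists_eq_smul_one_of_commute (T := ((u : S1 K) : EndP K)) fun i => by
      have h3 := congrArg (fun f : S1 K ≃ₐ[K] S1 K => ((f ⟨E K i 0, E_mem_S1 i 0⟩ : S1 K) : EndP K))
        (MonoidHom.mem_ker.1 h)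
      simp only [innerAut_S1_apply, AlgEquiv.one_apply] at h3
      calc ((u : S1 K) : EndP K) * E K i 0
          = ((u : S1 K) : EndP K) * E K i 0 * ((u⁻¹ : (S1 K)ˣ) : S1 K) * (u : S1 K) := by
            rw [mul_assoc _ _ ((u : S1 K) : EndP K), h2, mul_one]
        _ = E K i 0 * (u : S1 K) := by rw [h3]
    refine MonoidHom.mem_ker.2 (AlgEquiv.ext fun a => Subtype.ext ?_)
    rw [omegaS1_apply, hc, smul_mul_assoc, one_mul, ← mul_one (a : EndP K), ← mul_smul_comm, ← hc,
      mul_assoc, h1, mul_one, AlgEquiv.one_apply]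
  · intro h
    refine MonoidHom.mem_ker.2 (AlgEquiv.ext fun a => Subtype.ext ?_)
    have h3 := congrArg (fun f : G1 K => ((f ⟨a, S1_le_A1 a.2⟩ : A1 K) : EndP K))
      (MonoidHom.mem_ker.1 h)
    simp only [omegaS1_apply, AlgEquiv.one_apply] at h3
    rw [innerAut_S1_apply, h3, AlgEquiv.one_apply]

variable (K) in
theorem exists_innerAut_equiv : ∃ ι : (innerAut K (S1 K)).range ≃* innS1 K,
    ∀ u : (S1 K)ˣ, (ι ⟨innerAut K (S1 K) u, u, rfl⟩ : G1 K) = omegaS1 K u := by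
  unfold innS1
  refine ⟨((QuotientGroup.quotientKerEquivRange _).symm.trans
    (QuotientGroup.quotientMulEquivOfEq (ker_innerAut_S1 K))).trans
    (QuotientGroup.quotientKerEquivRange _), fun u => ?_⟩
  have h : (QuotientGroup.quotientKerEquivRange (innerAut K (S1 K))).symm
      ⟨innerAut K (S1 K) u, u, rfl⟩ = (u : (S1 K)ˣ ⧸ (innerAut K (S1 K)).ker) := by
    rw [MulEquiv.symm_apply_eq]
    rfl
  rw [MulEquiv.trans_apply, MulEquiv.trans_apply, h]
  rfl

/-! ### The group `𝓗` is free abelian; the complement `𝕋¹ × 𝕌₁` -/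

theorem eigen_injective : Function.Injective (eigen K) := by
  intro u v h
  refine Subtype.ext (Units.ext (Subtype.ext ?_))
  rw [← diagUnit_eigen, ← diagUnit_eigen, h]

instance diagUnitsCommGroup : CommGroup (diagUnits K) :=
  { (inferInstance : Group (diagUnits K)) with
    mul_comm := fun u v => eigen_injective (by rw [map_mul, map_mul, mul_comm]) }

variable (K) in
/-- The homomorphism `(n_i) ↦ ∏_{i ≥ 0} (H + i)^{n_i} ∏_{j ≥ 1} (H - j)_1^{n_{-j}}`. -/
def hProd : Multiplicative (ℤ →₀ ℤ) →* calH K where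
  toFun n := n.toAdd.prod fun i m => hGen K i ^ m
  map_one' := Finsupp.prod_zero_index
  map_mul' _ _ := Finsupp.prod_add_index' (fun _ => zpow_zero _) fun _ => zpow_add _

theorem hProd_single (i : ℤ) :
    hProd K (Multiplicative.ofAdd (Finsupp.single i 1)) = hGen K i := by
  change (Finsupp.single i (1 : ℤ)).prod _ = _
  rw [Finsupp.prod_single_index (zpow_zero _), zpow_one]

theorem hProd_surjective : Function.Surjective (hProd K) := by
  rintro ⟨u, hu⟩
  have h : calH K ≤ ((calH K).subtype.comp (hProd K)).range := by
    refine (Subgroup.closure_le _).2 ?_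
    rintro _ ⟨i, rfl⟩
    exact ⟨Multiplicative.ofAdd (Finsupp.single i 1), congrArg Subtype.val (hProd_single i)⟩
  obtain ⟨n, hn⟩ := h hu
  exact ⟨n, Subtype.ext hn⟩

theorem eigen_hProd (n : ℤ →₀ ℤ) (k : ℕ) :
    eigen K (hProd K (Multiplicative.ofAdd n)) k = ∏ i ∈ n.support, hSeq K i k ^ n i := by
  have h : eigen K (hProd K (Multiplicative.ofAdd n)) =
      ∏ i ∈ n.support, eigen K (hUnit K i) ^ n i := by
    change ((eigen K).comp (calH K).subtype) (∏ i ∈ n.support, hGen K i ^ n i) = _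
    rw [map_prod]
    exact Finset.prod_congr rfl fun i _ => map_zpow _ _ _
  rw [h, Finset.prod_apply]
  simp only [eigen_hUnit, Pi.pow_apply]

theorem rootMultiplicity_prod_X_add_C (s : Finset ℤ) (m : ℤ → ℕ) (hm : ∀ i ∉ s, m i = 0) (j : ℤ) :
    rootMultiplicity (-(j : K)) (∏ i ∈ s, (X + C ((i : ℤ) : K)) ^ m i) = m j := by
  classical
  rw [← count_roots, roots_prod _ _ (Finset.prod_ne_zero_iff.2 fun i _ => pow_ne_zero _ (X_add_C_ne_zero _)),
    Multiset.count_bind]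
  change ∑ i ∈ s, _ = _
  simp only [roots_pow, roots_X_add_C, Multiset.count_nsmul, Multiset.count_singleton, neg_inj,
    Int.cast_inj, mul_ite, mul_one, mul_zero]
  rw [Finset.sum_ite_eq]
  split_ifs with h
  · rfl
  · exact (hm j h).symm

/-- The functions `k ↦ k + i` are multiplicatively independent modulo scalars. -/
theorem eq_one_of_eventually_eq_one {c : Kˣ} {n : ℤ →₀ ℤ} (h : ∀ᶠ k : ℕ in Filter.atTop,
    c * eigen K (hProd K (Multiplicative.ofAdd n)) k = 1) : c = 1 ∧ n = 0 := by
  -- Splitting exponents into positive and negative parts turns the eventual identity `c ∏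
  -- (k+1+i)^(n i) = 1` into the polynomial identity `c P = Q`. Leading coefficients give `c = 1`,
  -- and root multiplicities give the exponents.
  set P : K[X] := ∏ i ∈ n.support, (X + C ((i + 1 : ℤ) : K)) ^ (n i).toNat with hP
  set Q : K[X] := ∏ i ∈ n.support, (X + C ((i + 1 : ℤ) : K)) ^ (-n i).toNat with hQ
  have hPQ : C (c : K) * P = Q := by
    refine eq_of_eventually_eval_eq ?_
    have hs := (Filter.eventually_all_finset n.support).2 fun i _ => eventually_hSeq (K := K) i
    filter_upwards [h, hs] with k hk hks
    have h1 (m : ℤ → ℕ) : (∏ i ∈ n.support, (X + C ((i + 1 : ℤ) : K)) ^ m i).eval (k : K) =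
        ((∏ i ∈ n.support, hSeq K i k ^ m i : Kˣ) : K) := by
      rw [eval_prod, Units.coe_prod]
      refine Finset.prod_congr rfl fun i hi => ?_
      rw [eval_pow, Units.val_pow_eq_pow_val, hks i hi]
    rw [eval_mul, eval_C, hP, hQ, h1, h1, ← Units.val_mul]
    congr 1
    rw [eigen_hProd] at hk
    rw [← mul_one (∏ i ∈ n.support, hSeq K i k ^ (-n i).toNat), ← hk, mul_left_comm,
      ← Finset.prod_mul_distrib]
    congr 1
    refine Finset.prod_congr rfl fun i _ => ?_
    rw [← zpow_natCast, ← zpow_natCast, ← zpow_add]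
    congr 1
    omega
  have hmonic (m : ℤ → ℕ) :
      (∏ i ∈ n.support, (X + C ((i + 1 : ℤ) : K)) ^ m i).Monic :=
    monic_prod_of_monic _ _ fun i _ => (monic_X_add_C _).pow _
  have hc : c = 1 := by
    have h1 := congrArg leadingCoeff hPQ
    rw [leadingCoeff_mul, leadingCoeff_C, (hmonic _).leadingCoeff, (hmonic _).leadingCoeff,
      mul_one] at h1
    exact Units.ext h1
  refine ⟨hc, Finsupp.ext fun j => ?_⟩
  rw [hc, Units.val_one, C_1, one_mul] at hPQ
  have hcount (m : ℤ → ℕ) (hm : ∀ i ∉ n.support, m i = 0) :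
      rootMultiplicity (-((j + 1 : ℤ) : K)) (∏ i ∈ n.support, (X + C ((i + 1 : ℤ) : K)) ^ m i) =
        m j := by
    -- The generator of index `i` contributes the root `-(i+1)`, hence the reindexing by one.
    have h1 : ∏ i ∈ n.support, (X + C ((i + 1 : ℤ) : K)) ^ m i =
        ∏ i ∈ n.support.map (addRightEmbedding 1), (X + C ((i : ℤ) : K)) ^ m (i - 1) := by
      rw [Finset.prod_map]
      simp
    rw [h1, rootMultiplicity_prod_X_add_C _ (fun i => m (i - 1)), add_sub_cancel_right]
    intro i hi
    refine hm _ fun hc => hi ?_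
    rw [Finset.mem_map]
    exact ⟨_, hc, by simp⟩
  have h1 := hcount (fun i => (n i).toNat) fun i hi => by simp [Finsupp.notMem_support_iff.1 hi]
  have h2 := hcount (fun i => (-n i).toNat) fun i hi => by simp [Finsupp.notMem_support_iff.1 hi]
  rw [← hP, hPQ] at h1
  rw [← hQ, h1] at h2
  -- The positive and negative parts of `n j` are now equal, which forces `n j = 0`.
  simp only [Finsupp.coe_zero, Pi.zero_apply]
  omega

variable (K) in
/-- The homomorphism `(λ, n) ↦ t_λ μ_{u(n)}`. -/
def outer : Kˣ × Multiplicative (ℤ →₀ ℤ) →* G1 K :=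
  (twist K).comp ((scalarUnit K).coprod ((calH K).subtype.comp (hProd K)))

theorem outer_apply (c : Kˣ) (n : Multiplicative (ℤ →₀ ℤ)) :
    outer K (c, n) = torus K c * mu K (hProd K n) := (torus_mul_mu _ _).symm

/-- Since `ω_v` fixes `x` modulo `F`, the eigenvalues attached to `q` are eventually `1`, and
independence applies. This yields both the trivial intersection with the inner part and the
injectivity of `outer`. -/
theorem eq_one_of_outer_eq_omegaGL {q : Kˣ × Multiplicative (ℤ →₀ ℤ)} {v : GLInf K}
    (h : outer K q = omegaGL K v) : q = 1 := by
  obtain ⟨c, n⟩ := q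
  have h1 := omegaGL_xA_sub_mem_F v
  rw [← h, outer_apply, torus_mul_mu] at h1
  obtain ⟨N, hN⟩ := mem_F_iff.1 h1
  obtain ⟨rfl, hn⟩ := eq_one_of_eventually_eq_one (c := c) (n := n.toAdd) <| by
    filter_upwards [Filter.eventually_ge_atTop N] with k hk
    have h2 := hN k hk
    rw [LinearMap.sub_apply, twist_xA_pow, opX_pow, sub_eq_zero, map_mul, eigen_scalarUnit] at h2
    have h3 := congrArg (fun p => coeff p (k + 1)) h2
    simp only [coeff_smul, coeff_X_pow, if_true, smul_eq_mul, mul_one] at h3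
    exact Units.ext h3
  rw [Prod.mk_eq_one]
  exact ⟨rfl, hn⟩

theorem outer_injective : Function.Injective (outer K) := by
  rw [injective_iff_map_eq_one]
  intro q hq
  exact eq_one_of_outer_eq_omegaGL (v := 1) (by rw [hq, map_one])

theorem exists_eq_outer_mul_omegaGL (σ : G1 K) :
    ∃ (q : Kˣ × Multiplicative (ℤ →₀ ℤ)) (v : GLInf K), σ = outer K q * omegaGL K v := by
  obtain ⟨c, u, v, h⟩ := exists_eq_torus_mul_mu_mul_omegaGL σ
  obtain ⟨n, rfl⟩ := hProd_surjective u
  exact ⟨(c, n), v, by rw [h, outer_apply]⟩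

theorem torus_eq_outer (c : Kˣ) : torus K c = outer K (c, 1) := by
  rw [outer_apply, map_one, map_one, mul_one]

theorem mu_hProd_eq_outer (n : Multiplicative (ℤ →₀ ℤ)) : mu K (hProd K n) = outer K (1, n) := by
  rw [outer_apply, map_one, one_mul]

theorem mu_hGen_eq_outer (i : ℤ) :
    mu K (hGen K i) = outer K (1, Multiplicative.ofAdd (Finsupp.single i 1)) := by
  rw [← mu_hProd_eq_outer, hProd_single]


/-! ### The determinant on `GL_∞(K)` and its kernel `E_∞(K)` -/

/-- The upper left `N × N` block of the matrix of an operator. -/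
def block (N : ℕ) (a : EndP K) : Matrix (Fin N) (Fin N) K :=
  Matrix.of fun i j => (a (X ^ (j : ℕ))).coeff i

/-- The operator is the direct sum of its upper left `N × N` block and the identity. -/
def IsBlock (N : ℕ) (a : EndP K) : Prop :=
  (∀ k, N ≤ k → a (X ^ k) = X ^ k) ∧ ∀ k < N, ∀ m, N ≤ m → (a (X ^ k)).coeff m = 0

theorem IsBlock.mono {N M : ℕ} {a : EndP K} (h : IsBlock N a) (hNM : N ≤ M) : IsBlock M a := by
  refine ⟨fun k hk => h.1 k (hNM.trans hk), fun k hk m hm => ?_⟩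
  by_cases hkN : k < N
  · exact h.2 k hkN m (hNM.trans hm)
  · rw [h.1 k (not_lt.1 hkN), coeff_X_pow, if_neg (by omega)]

theorem exists_isBlock {a : EndP K} (ha : a - 1 ∈ F K) : ∃ N, IsBlock N a := by
  obtain ⟨N, hN⟩ := mem_F_iff.1 ha
  -- The block must contain the nontrivial columns and also all the rows that these columns reach.
  set d := (Finset.range N).sup fun k => (a (X ^ k)).natDegree with hd
  have hN' (k : ℕ) (hk : N ≤ k) : a (X ^ k) = X ^ k := by
    have := hN k hk
    rwa [LinearMap.sub_apply, Module.End.one_apply, sub_eq_zero] at this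
  refine ⟨N + d + 1, fun k hk => hN' k (by omega), fun k hk m hm => ?_⟩
  by_cases hkN : k < N
  · refine coeff_eq_zero_of_natDegree_lt ?_
    have : (a (X ^ k)).natDegree ≤ d :=
      Finset.le_sup (f := fun k => (a (X ^ k)).natDegree) (Finset.mem_range.2 hkN)
    omega
  · rw [hN' k (not_lt.1 hkN), coeff_X_pow, if_neg (by omega)]

theorem IsBlock.one (N : ℕ) : IsBlock N (1 : EndP K) :=
  ⟨fun _ _ => rfl, fun k hk m hm => by
    rw [Module.End.one_apply, coeff_X_pow, if_neg (by omega)]⟩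

theorem coeff_mul_apply {N : ℕ} (a : EndP K) {b : EndP K} (hb : IsBlock N b) {k : ℕ} (hk : k < N)
    (m : ℕ) : ((a * b) (X ^ k)).coeff m =
      ∑ j : Fin N, (a (X ^ (j : ℕ))).coeff m * (b (X ^ k)).coeff j := by
  rw [Module.End.mul_apply, coeff_apply, Fin.sum_univ_eq_sum_range
    (fun j => (a (X ^ j)).coeff m * (b (X ^ k)).coeff j)]
  have hsub : (b (X ^ k)).support ⊆ Finset.range N := fun j hj => by
    rw [Finset.mem_range]
    by_contra hjN
    exact mem_support_iff.1 hj (hb.2 k hk j (not_lt.1 hjN))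
  rw [Finset.sum_subset hsub fun j _ hj => by rw [notMem_support_iff.1 hj, zero_mul]]
  exact Finset.sum_congr rfl fun j _ => mul_comm _ _

/-- The first `N` columns of `b` have no entries below row `N`, so the sum defining the product
stays inside the block, whatever `a` is. -/
theorem block_mul {N : ℕ} (a : EndP K) {b : EndP K} (hb : IsBlock N b) :
    block N (a * b) = block N a * block N b := by
  ext i j
  rw [Matrix.mul_apply]
  exact coeff_mul_apply a hb j.2 i

theorem IsBlock.mul {N : ℕ} {a b : EndP K} (ha : IsBlock N a) (hb : IsBlock N b) :
    IsBlock N (a * b) := by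
  refine ⟨fun k hk => by rw [Module.End.mul_apply, hb.1 k hk, ha.1 k hk], fun k hk m hm => ?_⟩
  rw [coeff_mul_apply a hb hk]
  exact Finset.sum_eq_zero fun j _ => by rw [ha.2 j j.2 m hm, zero_mul]

theorem IsBlock.ext {N : ℕ} {a b : EndP K} (ha : IsBlock N a) (hb : IsBlock N b)
    (h : block N a = block N b) : a = b := by
  refine end_ext fun k => ?_
  by_cases hk : k < N
  · refine Polynomial.ext fun m => ?_
    by_cases hm : m < N
    · exact congrFun (congrFun h ⟨m, hm⟩) ⟨k, hk⟩
    · rw [ha.2 k hk m (not_lt.1 hm), hb.2 k hk m (not_lt.1 hm)]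
  · rw [ha.1 k (not_lt.1 hk), hb.1 k (not_lt.1 hk)]

/-- The last column of the larger block is the last basis vector; expanding along it leaves the
smaller block. Thus the determinant does not depend on the size chosen. -/
theorem det_block_succ {N : ℕ} {a : EndP K} (ha : IsBlock N a) :
    (block (N + 1) a).det = (block N a).det := by
  rw [Matrix.det_succ_column _ (Fin.last N), Finset.sum_eq_single (Fin.last N)]
  · have h : (block (N + 1) a).submatrix (Fin.last N).succAbove (Fin.last N).succAbove =
        block N a := by
      ext i j
      simp [block]
    rw [h]
    simp [block, ha.1 N le_rfl, ← two_mul]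
  · intro i _ hi
    have h : (i : ℕ) ≠ N := fun e => hi (Fin.ext e)
    simp [block, ha.1 N le_rfl, coeff_X_pow, h]
  · simp

theorem det_block_of_le {N M : ℕ} {a : EndP K} (ha : IsBlock N a) (hNM : N ≤ M) :
    (block M a).det = (block N a).det := by
  induction M, hNM using Nat.le_induction with
  | base => rfl
  | succ M hM ih => rw [det_block_succ (ha.mono hM), ih]

theorem det_block_eq {N M : ℕ} {a : EndP K} (hN : IsBlock N a) (hM : IsBlock M a) :
    (block N a).det = (block M a).det := by
  rw [← det_block_of_le hN (le_max_left N M), det_block_of_le hM (le_max_right N M)]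

/-- The determinant of an operator in `1 + F`. -/
def detFun (a : onePlusF K) : K := (block (exists_isBlock a.2).choose (a : EndP K)).det

theorem detFun_eq {a : onePlusF K} {N : ℕ} (hN : IsBlock N (a : EndP K)) :
    detFun a = (block N (a : EndP K)).det :=
  det_block_eq (exists_isBlock a.2).choose_spec hN

variable (K) in
/-- The determinant on the monoid `1 + F`. -/
def detHom : onePlusF K →* K where
  toFun := detFun
  map_one' := by
    rw [detFun_eq (N := 0) (IsBlock.one 0), Matrix.det_fin_zero]
  map_mul' a b := by
    obtain ⟨N, hN⟩ := exists_isBlock a.2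
    obtain ⟨M, hM⟩ := exists_isBlock b.2
    have ha := hN.mono (le_max_left N M)
    have hb := hM.mono (le_max_right N M)
    rw [detFun_eq ha, detFun_eq hb, detFun_eq (a := a * b) (ha.mul hb), Submonoid.coe_mul,
      block_mul _ hb, Matrix.det_mul]

variable (K) in
/-- The determinant on `GL_∞(K)`. -/
def detGL : GLInf K →* Kˣ := Units.map (detHom K)

theorem detGL_eq {v : GLInf K} {N : ℕ} (hN : IsBlock N ((v : onePlusF K) : EndP K)) :
    (detGL K v : K) = (block N ((v : onePlusF K) : EndP K)).det := detFun_eq hN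

theorem detGL_muScalar (c : Kˣ) : detGL K (muScalar K c) = c := by
  have hval (k : ℕ) : (((muScalar K c : GLInf K) : onePlusF K) : EndP K) (X ^ k) =
      if k = 0 then (c : K) • (X ^ k : K[X]) else X ^ k := by
    change ((c : K) • E K 0 0 + 1 - E K 0 0) (X ^ k) = _
    rw [LinearMap.sub_apply, LinearMap.add_apply, LinearMap.smul_apply, E_pow]
    rcases Nat.eq_zero_or_pos k with rfl | hk
    · simp
    · simp [hk.ne, hk.ne']
  have hb : IsBlock 1 (((muScalar K c : GLInf K) : onePlusF K) : EndP K) := by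
    refine ⟨fun k hk => by rw [hval, if_neg (by omega)], fun k hk m hm => ?_⟩
    rw [hval, if_pos (by omega), coeff_smul, coeff_X_pow, if_neg (by omega), smul_zero]
  refine Units.ext ?_
  rw [detGL_eq hb, Matrix.det_fin_one]
  change ((((muScalar K c : GLInf K) : onePlusF K) : EndP K) (X ^ 0)).coeff 0 = _
  rw [hval]
  simp

variable (K) in
/-- The elementary matrix `1 + c E_{ij}`, `i ≠ j`, as an element of `GL_∞(K)`. -/
def elem {i j : ℕ} (hij : i ≠ j) (c : K) : GLInf K where
  val := ⟨1 + c • E K i j, by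
    change 1 + c • E K i j - 1 ∈ F K
    rw [add_sub_cancel_left]
    exact Submodule.smul_mem _ _ (E_mem_F i j)⟩
  inv := ⟨1 + (-c) • E K i j, by
    change 1 + (-c) • E K i j - 1 ∈ F K
    rw [add_sub_cancel_left]
    exact Submodule.smul_mem _ _ (E_mem_F i j)⟩
  val_inv := by
    ext1
    simp only [Submonoid.coe_mul, Submonoid.coe_one, mul_add, add_mul, mul_one, one_mul,
      smul_mul_assoc, mul_smul_comm, E_mul_E, hij.symm, if_false, smul_zero]
    module
  inv_val := by
    ext1
    simp only [Submonoid.coe_mul, Submonoid.coe_one, mul_add, add_mul, mul_one, one_mul,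
      smul_mul_assoc, mul_smul_comm, E_mul_E, hij.symm, if_false, smul_zero]
    module

theorem coe_elem {i j : ℕ} (hij : i ≠ j) (c : K) :
    ((elem K hij c : onePlusF K) : EndP K) = 1 + c • E K i j := rfl

theorem elem_mem_EInf {i j : ℕ} (hij : i ≠ j) (c : K) : elem K hij c ∈ EInf K :=
  Subgroup.subset_closure ⟨i, j, c, hij, rfl⟩

theorem elem_inv {i j : ℕ} (hij : i ≠ j) (c : K) : (elem K hij c)⁻¹ = elem K hij (-c) :=
  Units.ext rfl

open scoped commutatorElement in
/-- The group `E_∞(K)` is contained in the commutator subgroup of `GL_∞(K)`. -/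
theorem EInf_le_commutator : EInf K ≤ commutator (GLInf K) := by
  refine (Subgroup.closure_le _).2 ?_
  rintro v ⟨i, j, c, hij, hv⟩
  -- Infinitely many indices leave room for a third one `k`, and `1 + c E_{ij} = [1 + c E_{ik}, 1 +
  -- E_{kj}]`.
  obtain ⟨k, hk⟩ := Infinite.exists_notMem_finset ({i, j} : Finset ℕ)
  simp only [Finset.mem_insert, Finset.mem_singleton, not_or] at hk
  have hik : i ≠ k := fun h => hk.1 h.symm
  have hkj : k ≠ j := hk.2
  have h : v = ⁅elem K hik c, elem K hkj 1⁆ := by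
    refine GLInf_ext ?_
    rw [hv, commutatorElement_def, elem_inv, elem_inv]
    simp only [Units.val_mul, Submonoid.coe_mul, coe_elem, mul_add, add_mul, mul_one, one_mul,
      smul_mul_assoc, mul_smul_comm, E_mul_E, hik.symm, hkj.symm, hij.symm, if_true, if_false,
      smul_zero, add_zero]
    module
  rw [h]
  exact Subgroup.commutator_mem_commutator (Subgroup.mem_top _) (Subgroup.mem_top _)

theorem EInf_le_ker_detGL : EInf K ≤ (detGL K).ker :=
  EInf_le_commutator.trans (Abelianization.commutator_subset_ker _)

theorem isBlock_elem {N : ℕ} {i j : Fin N} (hij : (i : ℕ) ≠ j) (c : K) :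
    IsBlock N ((elem K hij c : onePlusF K) : EndP K) := by
  rw [coe_elem]
  refine ⟨fun k hk => ?_, fun k hk m hm => ?_⟩
  · rw [LinearMap.add_apply, LinearMap.smul_apply, E_pow, if_neg (by omega)]
    simp
  · rw [LinearMap.add_apply, LinearMap.smul_apply, E_pow, Module.End.one_apply, coeff_add,
      coeff_X_pow, if_neg (by omega), coeff_smul, zero_add]
    split_ifs
    · rw [coeff_X_pow, if_neg (by omega), smul_zero]
    · simp

theorem block_elem {N : ℕ} {i j : Fin N} (hij : i ≠ j) (hij' : (i : ℕ) ≠ j) (c : K) :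
    block N ((elem K hij' c : onePlusF K) : EndP K) =
      (Matrix.SpecialLinearGroup.transvection hij c : Matrix (Fin N) (Fin N) K) := by
  ext k l
  rw [coe_elem, Matrix.SpecialLinearGroup.transvection_coe, block, Matrix.of_apply,
    LinearMap.add_apply, LinearMap.smul_apply, E_pow, Module.End.one_apply, coeff_add, coeff_X_pow,
    Matrix.add_apply, Matrix.one_apply, Matrix.single_apply]
  simp only [Fin.ext_iff]
  congr 1
  by_cases h1 : (j : ℕ) = l
  · by_cases h2 : (i : ℕ) = k
    · simp [h1, h2]
    · simp [h1, h2, coeff_X_pow, Ne.symm h2]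
  · simp [h1]

open Matrix Matrix.SpecialLinearGroup in
-- Whitehead's identity `diag(a, a⁻¹) = w(a) w(-1)`, where `w(a)` is the product of the
-- transvections with parameters `a`, `-a⁻¹`, `a` in alternating positions.
theorem diag2n_eq_mul_transvection {ι : Type*} [Fintype ι] [DecidableEq ι] {i j : ι} (hij : i ≠ j)
    {a : K} (ha : a ≠ 0) : diag2n hij a ha =
      Matrix.SpecialLinearGroup.transvection hij a *
      Matrix.SpecialLinearGroup.transvection hij.symm (-a⁻¹) *
      Matrix.SpecialLinearGroup.transvection hij a *
      Matrix.SpecialLinearGroup.transvection hij (-1) *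
      Matrix.SpecialLinearGroup.transvection hij.symm 1 *
      Matrix.SpecialLinearGroup.transvection hij (-1) := by
  refine Subtype.ext ?_
  have hd : (diag2n hij a ha : Matrix ι ι K) =
      1 + single i i (a - 1) + single j j (a⁻¹ - 1) := by
    rw [diag2n_coe]
    ext k l
    simp only [diagonal_apply, Matrix.add_apply, Matrix.one_apply, single_apply]
    by_cases h1 : k = l
    · subst h1
      by_cases h2 : k = i
      · subst h2
        simp [hij.symm]
      · by_cases h3 : k = j
        · subst h3
          simp [h2, hij]
        · simp [h2, h3, Ne.symm h2, Ne.symm h3]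
    · have h2 : ¬ (i = k ∧ i = l) := fun h => h1 (h.1.symm.trans h.2)
      have h3 : ¬ (j = k ∧ j = l) := fun h => h1 (h.1.symm.trans h.2)
      simp [h1, h2, h3]
  refine hd.trans ?_
  -- Writing each single-entry matrix as a scalar times an opaque `e k l` reduces the identity to
  -- comparing scalar coefficients.
  obtain ⟨e, he⟩ : ∃ e : ι → ι → Matrix ι ι K, ∀ k l (c : K), single k l c = c • e k l :=
    ⟨fun k l => single k l 1, fun k l c => by rw [smul_single, smul_eq_mul, mul_one]⟩
  simp only [Matrix.SpecialLinearGroup.coe_mul, transvection_coe, mul_add, add_mul, mul_one,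
    one_mul, single_mul_single_same, single_mul_single_of_ne _ _ _ _ hij,
    single_mul_single_of_ne _ _ _ _ hij.symm, add_zero]
  simp only [he]
  match_scalars <;> field_simp <;> ring

/-- An element of determinant `1` is a block in some `SL_N(K)`, which is generated by transvections
and the matrices `diag(a, a⁻¹)`; the latter are products of transvections, and transvections are
blocks of elements of `E_∞(K)`. -/
theorem ker_detGL : (detGL K).ker = EInf K := by
  refine le_antisymm (fun v hv => ?_) EInf_le_ker_detGL
  obtain ⟨N₀, hN₀⟩ := exists_isBlock v.1.2
  -- Two extra rows make `Fin N` nontrivial even when `N₀ = 0`.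
  obtain ⟨N, hN⟩ : ∃ N, N = N₀ + 2 := ⟨_, rfl⟩
  have hb : IsBlock N ((v : onePlusF K) : EndP K) := hN₀.mono (by omega)
  have : Nontrivial (Fin N) := Fin.nontrivial_iff_two_le.2 (by omega)
  have hdet : (block N ((v : onePlusF K) : EndP K)).det = 1 := by
    rw [← detGL_eq hb, MonoidHom.mem_ker.1 hv, Units.val_one]
  let P : Matrix.SpecialLinearGroup (Fin N) K → Prop := fun M =>
    ∃ w ∈ EInf K, IsBlock N ((w : onePlusF K) : EndP K) ∧
      block N ((w : onePlusF K) : EndP K) = (M : Matrix (Fin N) (Fin N) K)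
  have hmul (A B) (hA : P A) (hB : P B) : P (A * B) := by
    obtain ⟨w, hw, h1, h2⟩ := hA
    obtain ⟨w', hw', h1', h2'⟩ := hB
    refine ⟨w * w', mul_mem hw hw', h1.mul h1', ?_⟩
    rw [Units.val_mul, Submonoid.coe_mul, block_mul _ h1', h2, h2',
      Matrix.SpecialLinearGroup.coe_mul]
  have htr (i j : Fin N) (hij : i ≠ j) (c : K) :
      P (Matrix.SpecialLinearGroup.transvection hij c) :=
    have hij' : (i : ℕ) ≠ j := fun h => hij (Fin.ext h)
    ⟨elem K hij' c, elem_mem_EInf _ _, isBlock_elem _ _, block_elem _ _ _⟩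
  obtain ⟨w, hw, h1, h2⟩ := Matrix.SpecialLinearGroup.diagonal_transvection_induction' P
    ⟨_, hdet⟩ (fun i j hij c hc => by
      rw [diag2n_eq_mul_transvection]
      exact hmul _ _ (hmul _ _ (hmul _ _ (hmul _ _ (hmul _ _ (htr _ _ _ _) (htr _ _ _ _))
        (htr _ _ _ _)) (htr _ _ _ _)) (htr _ _ _ _)) (htr _ _ _ _)) htr hmul
  have h3 : v = w := GLInf_ext (hb.ext h1 h2.symm)
  rwa [h3]

theorem twist_apply (u : diagUnits K) (a : A1 K) : (twist K u a : EndP K) =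
    (diagUnit (cumProd (eigen K u)) : EndP K) * a *
      ((diagUnit (cumProd (eigen K u)))⁻¹ : (EndP K)ˣ) := rfl

/-- The twist is conjugation by an invertible diagonal operator, which conjugates the block of `v`
by a diagonal matrix. The diagonal operator need not lie in `1 + F`, but the conjugate of `v` does.
-/
theorem detGL_of_conj_twist {u : diagUnits K} {v w : GLInf K}
    (h : omegaGL K w = twist K u * omegaGL K v * (twist K u)⁻¹) : detGL K w = detGL K v := by
  set d := cumProd (eigen K u) with hd
  set v₀ := ((v : onePlusF K) : EndP K) with hv₀
  set v₁ := (((v⁻¹ : GLInf K) : onePlusF K) : EndP K) with hv₁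
  have hval (k : ℕ) : ((diagUnit d : EndP K) * v₀ * ((diagUnit d)⁻¹ : (EndP K)ˣ)) (X ^ k) =
      ((d k : K))⁻¹ • (diagUnit d : EndP K) (v₀ (X ^ k)) := by
    rw [Module.End.mul_apply, Module.End.mul_apply, diagUnit_inv_pow, map_smul, map_smul]
  have hcoeff (p : K[X]) (m : ℕ) : ((diagUnit d : EndP K) p).coeff m = (d m : K) * p.coeff m := by
    rw [coeff_apply]
    simp only [diagUnit_pow, coeff_smul, coeff_X_pow, smul_eq_mul, mul_ite, mul_one, mul_zero]
    rw [Finset.sum_ite_eq]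
    split_ifs with hm
    · ring
    · rw [notMem_support_iff.1 hm, mul_zero]
  obtain ⟨N, hN⟩ := exists_isBlock v.1.2
  have hdN (k : ℕ) (hk : N ≤ k) : ((diagUnit d : EndP K) * v₀ * ((diagUnit d)⁻¹ : (EndP K)ˣ))
      (X ^ k) = X ^ k := by
    rw [hval, hN.1 k hk, diagUnit_pow, smul_smul, inv_mul_cancel₀ (Units.ne_zero _), one_smul]
  -- Both sides lie in `1 + F` and induce the same automorphism of `𝔸₁`, hence coincide.
  have hw : ((w : onePlusF K) : EndP K) =
      (diagUnit d : EndP K) * v₀ * ((diagUnit d)⁻¹ : (EndP K)ˣ) := by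
    refine eq_of_conj_eq (v' := (((w⁻¹ : GLInf K) : onePlusF K) : EndP K))
      (w' := (diagUnit d : EndP K) * v₁ * ((diagUnit d)⁻¹ : (EndP K)ˣ)) w.1.2
      (mem_F_iff.2 ⟨N, fun k hk => ?_⟩) (coe_inv_mul w) ?_ ?_ fun a => ?_
    · rw [LinearMap.sub_apply, hdN k hk, Module.End.one_apply, sub_self]
    · have := coe_inv_mul v
      simp only [mul_assoc, Units.inv_mul_cancel_left]
      rw [← mul_assoc v₁, this, one_mul, Units.mul_inv]
    · have := coe_mul_inv v
      simp only [mul_assoc, Units.inv_mul_cancel_left]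
      rw [← mul_assoc v₀, this, one_mul, Units.mul_inv]
    · have h1 := congrArg (fun f : G1 K => ((f a : A1 K) : EndP K)) h
      simp only [omegaGL_apply, AlgEquiv.mul_apply, ← map_inv, twist_apply] at h1
      rw [h1, ← hd]
      simp only [map_inv, inv_inv, mul_assoc]
      rfl
  have hwN : IsBlock N ((w : onePlusF K) : EndP K) := by
    rw [hw]
    refine ⟨hdN, fun k hk m hm => ?_⟩
    rw [hval, coeff_smul, hcoeff, hN.2 k hk m hm, mul_zero, smul_zero]
  refine Units.ext ?_
  rw [detGL_eq hN, detGL_eq hwN]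
  have hmat : block N ((w : onePlusF K) : EndP K) =
      Matrix.diagonal (fun i : Fin N => (d i : K)) * block N v₀ *
        Matrix.diagonal (fun i : Fin N => ((d i : K))⁻¹) := by
    ext i j
    rw [Matrix.mul_diagonal, Matrix.diagonal_mul, hw]
    simp only [block, Matrix.of_apply]
    rw [hval, coeff_smul, hcoeff, smul_eq_mul]
    ring
  rw [hmat, Matrix.det_mul, Matrix.det_mul, mul_right_comm, Matrix.det_diagonal,
    Matrix.det_diagonal, ← Finset.prod_mul_distrib]
  simp [hv₀]

/-- The determinant is invariant under the action of the automorphism group of `𝔸₁`. -/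
theorem detGL_of_conj {σ : G1 K} {v w : GLInf K}
    (h : omegaGL K w = σ * omegaGL K v * σ⁻¹) : detGL K w = detGL K v := by
  obtain ⟨c, u, g, rfl⟩ := exists_eq_torus_mul_mu_mul_omegaGL σ
  rw [torus_mul_mu] at h
  -- The inner factor `ω_g` only replaces `v` by a conjugate within `GL_∞(K)`, leaving the twist to
  -- be treated.
  have h1 : detGL K w = detGL K (g * v * g⁻¹) := by
    refine detGL_of_conj_twist (u := scalarUnit K c * (u : diagUnits K)) ?_
    rw [h, map_mul (omegaGL K), map_mul (omegaGL K), map_inv, mul_inv_rev]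
    simp only [mul_assoc]
  rw [h1, map_mul, map_mul, map_inv, mul_inv_cancel_comm]

/-! ### The semidirect product and the abelianization -/

variable (K)

/-- The action of `𝔾₁` on `GL_∞(K)` that corresponds to conjugation on `{ω_v | v ∈ GL_∞(K)}`. -/
def conjAction : G1 K →* MulAut (GLInf K) :=
  haveI := normal_range_omegaGL (K := K)
  (MulAut.congr (MonoidHom.ofInjective (omegaGL_injective (K := K))).symm).toMonoidHom.comp
    MulAut.conjNormal

variable {K} in
theorem omegaGL_conjAction (σ : G1 K) (v : GLInf K) :
    omegaGL K (conjAction K σ v) = σ * omegaGL K v * σ⁻¹ := by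
  have := normal_range_omegaGL (K := K)
  have h : omegaGL K (conjAction K σ v) =
      (MulAut.conjNormal σ (MonoidHom.ofInjective (omegaGL_injective (K := K)) v) : G1 K) :=
    MonoidHom.apply_ofInjective_symm (omegaGL_injective (K := K)) _
  rw [h, MulAut.conjNormal_apply]
  rfl

/-- The homomorphism `(v, q) ↦ ω_v q`. -/
def semidirectHom :
    GLInf K ⋊[(conjAction K).comp (outer K)] (Kˣ × Multiplicative (ℤ →₀ ℤ)) →* G1 K :=
  SemidirectProduct.lift (omegaGL K) (outer K) fun q => MonoidHom.ext fun v =>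
    omegaGL_conjAction (outer K q) v

variable {K} in
theorem outer_mul_omegaGL (q : Kˣ × Multiplicative (ℤ →₀ ℤ)) (v : GLInf K) :
    outer K q * omegaGL K v =
      semidirectHom K (SemidirectProduct.inr q * SemidirectProduct.inl v) := by
  rw [map_mul, semidirectHom, SemidirectProduct.lift_inr, SemidirectProduct.lift_inl]

theorem semidirectHom_bijective : Function.Bijective (semidirectHom K) := by
  constructor
  · rw [injective_iff_map_eq_one]
    intro x hx
    rw [← SemidirectProduct.inl_left_mul_inr_right x, map_mul, semidirectHom,
      SemidirectProduct.lift_inl, SemidirectProduct.lift_inr, mul_eq_one_iff_inv_eq, ← map_inv]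
      at hx
    have hq := eq_one_of_outer_eq_omegaGL hx.symm
    rw [hq, map_one, ← map_one (omegaGL K)] at hx
    have hv := omegaGL_injective hx
    rw [← SemidirectProduct.inl_left_mul_inr_right x, hq, inv_eq_one.1 hv, map_one, map_one,
      mul_one]
  · intro σ
    obtain ⟨q, v, rfl⟩ := exists_eq_outer_mul_omegaGL σ
    exact ⟨_, (outer_mul_omegaGL q v).symm⟩

/-- The isomorphism `𝔾₁ ≃ (K^* × ℤ^(ℤ)) ⋉ GL_∞(K)`. -/
def semidirectEquiv :
    G1 K ≃* GLInf K ⋊[(conjAction K).comp (outer K)] (Kˣ × Multiplicative (ℤ →₀ ℤ)) :=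
  (MulEquiv.ofBijective _ (semidirectHom_bijective K)).symm

variable {K}

theorem semidirectEquiv_outer (q : Kˣ × Multiplicative (ℤ →₀ ℤ)) :
    semidirectEquiv K (outer K q) = SemidirectProduct.inr q := by
  rw [semidirectEquiv, MulEquiv.symm_apply_eq, MulEquiv.ofBijective_apply, semidirectHom,
    SemidirectProduct.lift_inr]

theorem semidirectEquiv_omegaGL (v : GLInf K) :
    semidirectEquiv K (omegaGL K v) = SemidirectProduct.inl v := by
  rw [semidirectEquiv, MulEquiv.symm_apply_eq, MulEquiv.ofBijective_apply, semidirectHom,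
    SemidirectProduct.lift_inl]

variable (K) in
/-- The homomorphism `t_λ μ_{u(n)} ω_v ↦ (λ, n, det v)`. -/
def abelHom : G1 K →* Kˣ × Multiplicative (ℤ →₀ ℤ) × Kˣ :=
  (MulEquiv.prodAssoc.toMonoidHom.comp (SemidirectProduct.rightHom.prod
    (SemidirectProduct.lift (detGL K) 1 fun q => MonoidHom.ext fun v => by
      change detGL K (conjAction K (outer K q) v) = 1 * detGL K v * 1⁻¹
      rw [one_mul, inv_one, mul_one]
      exact detGL_of_conj (omegaGL_conjAction (outer K q) v)))).comp
    (semidirectEquiv K).toMonoidHom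

theorem abelHom_outer (c : Kˣ) (n : Multiplicative (ℤ →₀ ℤ)) :
    abelHom K (outer K (c, n)) = (c, n, 1) := by
  change MulEquiv.prodAssoc ((SemidirectProduct.rightHom.prod _)
    (semidirectEquiv K (outer K (c, n)))) = _
  rw [semidirectEquiv_outer, MonoidHom.prod_apply, SemidirectProduct.rightHom_inr,
    SemidirectProduct.lift_inr]
  rfl

theorem abelHom_omegaGL (v : GLInf K) : abelHom K (omegaGL K v) = (1, 1, detGL K v) := by
  change MulEquiv.prodAssoc ((SemidirectProduct.rightHom.prod _)
    (semidirectEquiv K (omegaGL K v))) = _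
  rw [semidirectEquiv_omegaGL, MonoidHom.prod_apply, SemidirectProduct.rightHom_inl,
    SemidirectProduct.lift_inl]
  rfl

theorem abelHom_outer_mul_omegaGL (c : Kˣ) (n : Multiplicative (ℤ →₀ ℤ)) (v : GLInf K) :
    abelHom K (outer K (c, n) * omegaGL K v) = (c, n, detGL K v) := by
  rw [map_mul, abelHom_outer, abelHom_omegaGL]
  simp

theorem abelHom_surjective : Function.Surjective (abelHom K) := by
  rintro ⟨c, n, d⟩
  exact ⟨outer K (c, n) * omegaGL K (muScalar K d), by
    rw [abelHom_outer_mul_omegaGL, detGL_muScalar]⟩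

variable (K)

theorem ker_abelHom : (abelHom K).ker = (EInf K).map (omegaGL K) := by
  ext σ
  constructor
  · intro h
    obtain ⟨⟨c, n⟩, v, rfl⟩ := exists_eq_outer_mul_omegaGL σ
    rw [MonoidHom.mem_ker, abelHom_outer_mul_omegaGL, Prod.mk_eq_one, Prod.mk_eq_one] at h
    obtain ⟨rfl, rfl, hv⟩ := h
    refine ⟨v, ?_, ?_⟩
    · rw [← ker_detGL]
      exact hv
    · rw [← Prod.one_eq_mk, map_one, one_mul]
  · rintro ⟨v, hv, rfl⟩
    rw [← ker_detGL] at hv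
    rw [MonoidHom.mem_ker, abelHom_omegaGL, MonoidHom.mem_ker.1 hv]
    rfl

/-- One inclusion holds because the target is abelian. For the other, the kernel is the image of
`E_∞(K)`, whose elements are already products of commutators in `GL_∞(K)`. -/
theorem commutator_eq_ker_abelHom : commutator (G1 K) = (abelHom K).ker := by
  refine le_antisymm (Abelianization.commutator_subset_ker _) ?_
  rw [ker_abelHom]
  refine (Subgroup.map_mono EInf_le_commutator).trans ?_
  rw [commutator_def, Subgroup.map_commutator, commutator_def]
  exact Subgroup.commutator_mono le_top le_top

/-- The abelianization of `𝔾₁`. -/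
def abelEquiv : Abelianization (G1 K) ≃* Kˣ × Multiplicative (ℤ →₀ ℤ) × Kˣ :=
  (QuotientGroup.quotientMulEquivOfEq (commutator_eq_ker_abelHom K)).trans
    (QuotientGroup.quotientKerEquivOfSurjective _ abelHom_surjective)

variable {K} in
theorem abelEquiv_of (σ : G1 K) : abelEquiv K (Abelianization.of σ) = abelHom K σ := rfl

variable {K} in
theorem torus_injective : Function.Injective (torus K) := fun c d h => by
  rw [torus_eq_outer, torus_eq_outer] at h
  exact congrArg Prod.fst (outer_injective h)

variable {K} in
theorem mu_comp_hProd_injective : Function.Injective ((mu K).comp (hProd K)) := fun n m h => by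
  rw [MonoidHom.comp_apply, MonoidHom.comp_apply, mu_hProd_eq_outer, mu_hProd_eq_outer] at h
  exact congrArg Prod.snd (outer_injective h)

variable {K} in
theorem muScalar_injective : Function.Injective (muScalar K) := fun c d h => by
  rw [← detGL_muScalar c, h, detGL_muScalar]

theorem range_mu_comp_hProd : ((mu K).comp (hProd K)).range = U1 K := by
  rw [MonoidHom.range_comp, MonoidHom.range_eq_top.2 hProd_surjective, ← MonoidHom.range_eq_map]
  rfl

theorem T1_sup_U1 : T1 K ⊔ U1 K = (outer K).range := by
  refine le_antisymm (sup_le ?_ ?_) ?_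
  · rintro _ ⟨c, rfl⟩
    exact ⟨(c, 1), (torus_eq_outer c).symm⟩
  · rintro _ ⟨u, rfl⟩
    obtain ⟨n, rfl⟩ := hProd_surjective u
    exact ⟨(1, n), (mu_hProd_eq_outer n).symm⟩
  · rintro _ ⟨⟨c, n⟩, rfl⟩
    rw [outer_apply]
    exact mul_mem (Subgroup.mem_sup_left ⟨c, rfl⟩) (Subgroup.mem_sup_right ⟨_, rfl⟩)

theorem disjoint_T1_U1 : Disjoint (T1 K) (U1 K) := by
  rw [Subgroup.disjoint_def]
  rintro _ ⟨c, rfl⟩ ⟨u, hu⟩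
  obtain ⟨n, rfl⟩ := hProd_surjective u
  rw [mu_hProd_eq_outer, torus_eq_outer] at hu
  have h : 1 = c := congrArg Prod.fst (outer_injective hu)
  rw [← h, map_one]

theorem commute_T1_U1 : ∀ t ∈ T1 K, ∀ m ∈ U1 K, t * m = m * t := by
  rintro _ ⟨c, rfl⟩ _ ⟨u, rfl⟩
  change twist K (scalarUnit K c) * twist K u = twist K u * twist K (scalarUnit K c)
  rw [← map_mul, ← map_mul, mul_comm]

theorem isComplement'_innS1 : (T1 K ⊔ U1 K).IsComplement' (innS1 K) := by
  rw [T1_sup_U1, ← range_omegaGL]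
  refine Subgroup.isComplement'_of_disjoint_and_mul_eq_univ ?_ ?_
  · rw [Subgroup.disjoint_def]
    rintro _ ⟨q, rfl⟩ ⟨v, hv⟩
    rw [eq_one_of_outer_eq_omegaGL hv.symm, map_one]
  · refine Set.eq_univ_of_forall fun σ => ?_
    obtain ⟨q, v, rfl⟩ := exists_eq_outer_mul_omegaGL σ
    exact Set.mul_mem_mul ⟨q, rfl⟩ ⟨v, rfl⟩

/-- On `U(K)` the determinant inverts `λ ↦ μ(λ)`, so the third coordinate `det v` recovers `v`
itself. -/
theorem exists_abelianization_equiv : ∃ e : Abelianization (G1 K) ≃* T1 K × U1 K × UK K,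
    ∀ (t : T1 K) (m : U1 K) (v : UK K),
      e (Abelianization.of ((t : G1 K) * m * omegaGL K v)) = (t, m, v) := by
  have eU : ∃ e : Multiplicative (ℤ →₀ ℤ) ≃* U1 K, ∀ n, (e n : G1 K) = mu K (hProd K n) :=
    ⟨(MonoidHom.ofInjective mu_comp_hProd_injective).trans
      (MulEquiv.subgroupCongr (range_mu_comp_hProd K)), fun _ => rfl⟩
  obtain ⟨eU, heU⟩ := eU
  let eT : Kˣ ≃* T1 K := MonoidHom.ofInjective torus_injective
  let eV : Kˣ ≃* UK K := MonoidHom.ofInjective muScalar_injective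
  refine ⟨(abelEquiv K).trans (eT.prodCongr (eU.prodCongr eV)), fun t m v => ?_⟩
  obtain ⟨c, rfl⟩ := eT.surjective t
  obtain ⟨n, rfl⟩ := eU.surjective m
  obtain ⟨d, rfl⟩ := eV.surjective v
  have hT : (eT c : G1 K) = torus K c := rfl
  have hV : (eV d : GLInf K) = muScalar K d := rfl
  rw [MulEquiv.trans_apply, hT, hV, heU, ← outer_apply, abelEquiv_of, abelHom_outer_mul_omegaGL,
    detGL_muScalar]
  rfl

theorem closure_generators :
    Subgroup.closure (Set.range (torus K) ∪ Set.range (fun i : ℕ => mu K (hGen K i)) ∪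
      {g | ∃ j : ℕ, 1 ≤ j ∧ g = mu K (hGen K (-(j : ℤ)))} ∪ Set.range (omegaGL K)) = ⊤ := by
  set C := Subgroup.closure (Set.range (torus K) ∪ Set.range (fun i : ℕ => mu K (hGen K i)) ∪
      {g | ∃ j : ℕ, 1 ≤ j ∧ g = mu K (hGen K (-(j : ℤ)))} ∪ Set.range (omegaGL K))
  refine eq_top_iff.2 fun σ _ => ?_
  obtain ⟨c, u, v, rfl⟩ := exists_eq_torus_mul_mu_mul_omegaGL σ
  have hgen (i : ℤ) : hGen K i ∈ C.comap (mu K) := by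
    rw [Subgroup.mem_comap]
    rcases Int.eq_nat_or_neg i with ⟨j, rfl | rfl⟩
    · exact Subgroup.subset_closure (Or.inl (Or.inl (Or.inr ⟨j, rfl⟩)))
    -- The index `-0` belongs to the first family, `H + 0`.
    · rcases Nat.eq_zero_or_pos j with rfl | hj
      · exact Subgroup.subset_closure (Or.inl (Or.inl (Or.inr ⟨0, rfl⟩)))
      · exact Subgroup.subset_closure (Or.inl (Or.inr ⟨j, hj, rfl⟩))
  have hu : mu K u ∈ C := by
    obtain ⟨n, rfl⟩ := hProd_surjective u
    have : hProd K n ∈ C.comap (mu K) :=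
      Subgroup.prod_mem _ fun i _ => Subgroup.zpow_mem _ (hgen i) _
    exact this
  exact mul_mem (mul_mem (Subgroup.subset_closure (Or.inl (Or.inl (Or.inl ⟨c, rfl⟩)))) hu)
    (Subgroup.subset_closure (Or.inr ⟨v, rfl⟩))

end

end JacobianAlgebra

open JacobianAlgebra

theorem mainTheorem3 (K : Type*) [Field K] [CharZero K] :
    -- the inner automorphisms of `𝕊₁` are identified with a subgroup of `𝔾₁`,
    (∃ ι : (innerAut K (S1 K)).range ≃* innS1 K,
      ∀ u : (S1 K)ˣ, (ι ⟨innerAut K (S1 K) u, u, rfl⟩ : G1 K) = omegaS1 K u) ∧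
    -- and `𝔾₁ = (𝕋¹ × 𝕌₁) ⋉ Inn(𝕊₁)`
    (Disjoint (T1 K) (U1 K) ∧ (∀ t ∈ T1 K, ∀ m ∈ U1 K, t * m = m * t) ∧
      (innS1 K).Normal ∧ (T1 K ⊔ U1 K).IsComplement' (innS1 K)) ∧
    -- `𝔾₁ ≃ (𝕋¹ × ℤ^(ℤ)) ⋉ GL_∞(K)`
    (∃ (φ : Kˣ × Multiplicative (ℤ →₀ ℤ) →* MulAut (GLInf K))
      (e : G1 K ≃* GLInf K ⋊[φ] (Kˣ × Multiplicative (ℤ →₀ ℤ))),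
      (∀ c : Kˣ, e (torus K c) = SemidirectProduct.inr (c, 1)) ∧
      (∀ i : ℤ, e (mu K (hGen K i)) =
        SemidirectProduct.inr (1, Multiplicative.ofAdd (Finsupp.single i 1))) ∧
      (∀ v : GLInf K, e (omegaGL K v) = SemidirectProduct.inl v)) ∧
    -- `[𝔾₁, 𝔾₁] = {ω_u | u ∈ E_∞(K)}`
    commutator (G1 K) = (EInf K).map (omegaGL K) ∧
    -- `𝔾₁ / [𝔾₁, 𝔾₁] ≃ 𝕋¹ × 𝕌₁ × U(K)`
    (∃ e : Abelianization (G1 K) ≃* T1 K × U1 K × UK K,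
      ∀ (t : T1 K) (m : U1 K) (v : UK K),
        e (Abelianization.of ((t : G1 K) * m * omegaGL K v)) = (t, m, v)) ∧
    -- `𝔾₁ / [𝔾₁, 𝔾₁] ≃ K^* × ℤ^(ℤ) × K^*`
    (∃ e : Abelianization (G1 K) ≃* Kˣ × Multiplicative (ℤ →₀ ℤ) × Kˣ,
      (∀ c : Kˣ, e (Abelianization.of (torus K c)) = (c, 1, 1)) ∧
      (∀ i : ℤ, e (Abelianization.of (mu K (hGen K i))) =
        (1, Multiplicative.ofAdd (Finsupp.single i 1), 1)) ∧
      (∀ c : Kˣ, e (Abelianization.of (omegaGL K (muScalar K c))) = (1, 1, c))) ∧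
    -- generators of `𝔾₁`
    Subgroup.closure (Set.range (torus K) ∪ Set.range (fun i : ℕ => mu K (hGen K i)) ∪
      {g | ∃ j : ℕ, 1 ≤ j ∧ g = mu K (hGen K (-(j : ℤ)))} ∪ Set.range (omegaGL K)) = ⊤ := by
  have hnormal : (innS1 K).Normal := range_omegaGL (K := K) ▸ normal_range_omegaGL
  refine ⟨exists_innerAut_equiv K,
    ⟨disjoint_T1_U1 K, commute_T1_U1 K, hnormal, isComplement'_innS1 K⟩,
    ⟨_, semidirectEquiv K, fun c => ?_, fun i => ?_, semidirectEquiv_omegaGL⟩,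
    (commutator_eq_ker_abelHom K).trans (ker_abelHom K), exists_abelianization_equiv K,
    ⟨abelEquiv K, fun c => ?_, fun i => ?_, fun c => ?_⟩, closure_generators K⟩
  · rw [torus_eq_outer, semidirectEquiv_outer]
  · rw [mu_hGen_eq_outer, semidirectEquiv_outer]
  · rw [abelEquiv_of, torus_eq_outer, abelHom_outer]
  · rw [abelEquiv_of, mu_hGen_eq_outer, abelHom_outer]
  · rw [abelEquiv_of, abelHom_omegaGL, detGL_muScalar]
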